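/- Let $\mathcal H$ be a separable (possibly finite-dimensional) complex Hilbert space, $X$ a locally compact Hausdorff space with its Borel $\sigma$-algebra, and $\mathcal S(\mathcal K)$ the set of positive trace-one operators on a Hilbert space $\mathcal K$. Let $\nu$ be a positive operator-valued measure (POVM) on $X$ with values in $\mathcal B(\mathcal H)$, that is, positive and ultraweakly countably additive; let $\rho\in\mathcal S(\mathcal H)$ be of full rank (injective), $\mu:=\nu_\rho=\operatorname{tr}(\rho\,\nu(\cdot))$, and assume that the entrywise Radon–Nikodým derivative $D=\frac{d\nu}{d\mu}$ takes values in the bounded operators. Assume also that the tensor POVM $$\nu\otimes_{\mu}\nu(E)=\int_E D\otimes D\,d\mu$$ (ultraweak integral) exists as a POVM with values in $\mathcal B(\mathcal H\otimes\mathcal H)$; its derivative with respect to $\mu$ is $D\otimes D$. For a POVM $\kappa$ on $X$ with values in $\mathcal B(\mathcal K)$ having a bounded-operator-valued derivative $\frac{d\kappa}{d\mu}$, for $s\in\mathcal S(\mathcal K)$ and $F:X\to\mathcal B(\mathcal K)$ put $$F_s(x)=\operatorname{tr}\Big(s\,\tfrac{d\kappa}{d\mu}(x)^{1/2}F(x)\tfrac{d\kappa}{d\mu}(x)^{1/2}\Big).$$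 A quantum random variable is a function $F:X\to\mathcal B(\mathcal K)$ with $x\mapsto \operatorname{tr}(sF(x))$ measurable for all $s\in\mathcal S(\mathcal K)$, and $\mathcal L_{\mathcal K}$ is the complex span of the positive quantum random variables. For $1\le p<\infty$ and $F\in\mathcal L_{\mathcal K}$ put $$\|F\|_p=\inf\Big\{\sup_{s\in\mathcal S(\mathcal K)}\big\|(F_1+F_2+F_3+F_4)_s\big\|_{L^p(\mu)}: F=F_1-F_2+iF_3-iF_4,\ 0\le F_k\in\mathcal L_{\mathcal K}\Big\},$$ $$\|F\|_{p,dec}=\inf\Big\{\max(\|S_1\|_p,\|S_2\|_p): 0\le S_1,S_2\in\mathcal L_{\mathcal K},\ \begin{bmatrix}S_1&F\\F^*&S_2\end{bmatrix}\ge0\ \mu\text{-a.e.}\Big\},$$ and let $L^p_{\mathcal K}(X,\kappa)$ consist of the $F\in\mathcal L_{\mathcal K}$ with $\|F\|_p<\infty$. Let $\mathcal S_{sep}\subset\mathcal S(\mathcal H\otimes\mathcal H)$ be the closure in $\mathcal S(\mathcal H\otimes\mathcal H)$ of the convex hull of the product states $s_1\otimes s_2$, $s_1,s_2\in\mathcal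 S(\mathcal H)$. For $F:X\to\mathcal B(\mathcal H\otimes\mathcal H)$, with $F_s$ formed with respect to $\nu\otimes_\mu\nu$, put $$\|F\|_{1,sep,\nu\otimes_\mu\nu}=\sup_{s\in\mathcal S_{sep}}\|F_s\|_{L^1(\mu)},$$ $$\|F\|_{1,sep,dec}=\inf\Big\{\max_i\|S_i\|_{1,sep,\nu\otimes_\mu\nu}: 0\le S_1,S_2\in\mathcal L_{\mathcal H\otimes\mathcal H},\ \begin{bmatrix}S_1&F\\F^*&S_2\end{bmatrix}\ge0\ \mu\text{-a.e.}\Big\}.$$ **Theorem.** Let $1<p,q<\infty$ with $\frac1p+\frac1q=1$, let $f\in L^p_{\mathcal H}(X,\nu)$, $g\in L^q_{\mathcal H}(X,\nu)$, and let $(f\otimes g)(x)=f(x)\otimes g(x)$. Then $$\|f\otimes g\|_{1,sep,\nu\otimes_{\nu_\rho}\nu}\le\|f\|_p\,\|g\|_q\qquad\text{and}\qquad \|f\otimes g\|_{1,sep,dec}\le\|f\|_{p,dec}\,\|g\|_{q,dec}.$$ If $\mathcal H$ is finite-dimensional, the second inequality also holds when $S_1,S_2$ in the definition of $\|\cdot\|_{1,sep,dec}$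 are restricted to $L^1_{\mathcal H\otimes\mathcal H}(X,\nu\otimes_{\nu_\rho}\nu)$. -/

import Mathlib

open MeasureTheory
open scoped TensorProduct ENNReal ComplexOrder

noncomputable section

namespace QRV

section Trace

variable {K : Type*} [NormedAddCommGroup K] [InnerProductSpace ℂ K] [CompleteSpace K]

/-- Index set of a fixed orthonormal (Hilbert) basis of `K`. -/
def onbIndex (K : Type*) [NormedAddCommGroup K] [InnerProductSpace ℂ K] [CompleteSpace K] :
    Set K :=
  (exists_hilbertBasis ℂ K).choose

/-- A fixed orthonormal (Hilbert) basis of `K`. -/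
def onb (K : Type*) [NormedAddCommGroup K] [InnerProductSpace ℂ K] [CompleteSpace K] :
    HilbertBasis (onbIndex K) ℂ K :=
  (exists_hilbertBasis ℂ K).choose_spec.choose

/-- The trace `∑ i, ⟨e i, T (e i)⟩`. It is only used for operators `T = s * A` with `s` a density
operator, for which the sum converges absolutely and does not depend on the basis. -/
def tr (T : K →L[ℂ] K) : ℂ :=
  ∑' i, inner ℂ (onb K i) (T (onb K i))

/-- States (density operators): positive operators of trace one. -/
def IsState (s : K →L[ℂ] K) : Prop :=
  0 ≤ s ∧ HasSum (fun i => inner ℂ (onb K i) (s (onb K i))) 1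

theorem hasSum_norm_inner_sq (x : K) :
    HasSum (fun i => ‖inner ℂ (onb K i) x‖ ^ 2) (‖x‖ ^ 2) := by
  have h := Complex.hasSum_re ((onb K).hasSum_inner_mul_inner x x)
  have e : ∀ i, (inner ℂ x (onb K i) * inner ℂ (onb K i) x : ℂ).re
      = ‖inner ℂ (onb K i) x‖ ^ 2 := by
    intro i
    rw [← inner_conj_symm x (onb K i), Complex.conj_mul']
    norm_cast
  have e2 : (inner ℂ x x : ℂ).re = ‖x‖ ^ 2 := by
    rw [inner_self_eq_norm_sq_to_K]; norm_cast
  rw [e2] at h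
  simpa only [e] using h

/-- `tr (s A) ≥ 0` for a state `s` and a positive operator `A`. -/
theorem tr_state_mul_nonneg {s A : K →L[ℂ] K} (hs : IsState s) (hA : 0 ≤ A) :
    0 ≤ (tr (s * A)).re := by
  set b := onb K
  set R : K →L[ℂ] K := CFC.sqrt s with hR
  have hR0 : 0 ≤ R := CFC.sqrt_nonneg s
  have hRR : R * R = s := CFC.sqrt_mul_sqrt_self s hs.1
  have hRsymm : ∀ x y, inner ℂ (R x) y = inner ℂ x (R y) := fun x y =>
    ((ContinuousLinearMap.nonneg_iff_isPositive R).1 hR0).isSymmetric x y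
  have hAsymm : ∀ x y, inner ℂ (A x) y = inner ℂ x (A y) := fun x y =>
    ((ContinuousLinearMap.nonneg_iff_isPositive A).1 hA).isSymmetric x y
  have hsR : ∀ x, s x = R (R x) := fun x => by rw [← hRR]; rfl
  have hsumR : Summable fun i => ‖R (b i)‖ ^ 2 := by
    have h := (Complex.hasSum_re hs.2).summable
    refine h.congr fun i => ?_
    rw [hsR, ← hRsymm, inner_self_eq_norm_sq_to_K]
    norm_cast
  set φ : onbIndex K × onbIndex K → ℂ := fun q =>
    inner ℂ (R (b q.1)) (b q.2) * inner ℂ (b q.2) (R (A (b q.1))) with hφ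
  have h1 : Summable fun q : onbIndex K × onbIndex K => ‖inner ℂ (b q.2) (R (b q.1))‖ ^ 2 := by
    refine (summable_prod_of_nonneg fun _ => by positivity).2 ⟨fun i => ?_, ?_⟩
    · exact (hasSum_norm_inner_sq (R (b i))).summable
    · refine hsumR.congr fun i => ?_
      exact (hasSum_norm_inner_sq (R (b i))).tsum_eq.symm
  have h2 : Summable fun q : onbIndex K × onbIndex K =>
      ‖inner ℂ (b q.2) (A (R (b q.1)))‖ ^ 2 := by
    refine (summable_prod_of_nonneg fun _ => by positivity).2 ⟨fun i => ?_, ?_⟩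
    · exact (hasSum_norm_inner_sq (A (R (b i)))).summable
    · have : ∀ i, ∑' j, ‖inner ℂ (b j) (A (R (b i)))‖ ^ 2 = ‖A (R (b i))‖ ^ 2 :=
        fun i => (hasSum_norm_inner_sq (A (R (b i)))).tsum_eq
      simp only [this]
      refine Summable.of_nonneg_of_le (fun _ => by positivity) (fun i => ?_)
        (hsumR.mul_left (‖A‖ ^ 2))
      rw [← mul_pow]
      gcongr
      exact A.le_opNorm _
  have e1 : ∀ i j, inner ℂ (b j) (R (A (b i))) = inner ℂ (A (R (b j))) (b i) := fun i j => by
    rw [← hRsymm, ← hAsymm]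
  have hφs : Summable φ := by
    refine Summable.of_norm_bounded (h1.add h2.prod_symm) fun q => ?_
    simp only [hφ, Prod.fst_swap, Prod.snd_swap, norm_mul]
    rw [e1, norm_inner_symm (R (b q.1)), norm_inner_symm (A (R (b q.2)))]
    nlinarith [sq_nonneg (‖inner ℂ (b q.2) (R (b q.1))‖ - ‖inner ℂ (b q.1) (A (R (b q.2)))‖),
      sq_nonneg (‖inner ℂ (b q.2) (R (b q.1))‖), sq_nonneg (‖inner ℂ (b q.1) (A (R (b q.2)))‖)]
  have etr : tr (s * A) = ∑' i, ∑' j, φ (i, j) := by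
    unfold tr
    refine tsum_congr fun i => ?_
    rw [mul_apply_eq_comp, hsR, ← hRsymm]
    exact (b.tsum_inner_mul_inner (R (b i)) (R (A (b i)))).symm
  have eswap : ∀ j, ∑' i, φ (i, j) = inner ℂ (A (R (b j))) (R (b j)) := fun j => by
    rw [← b.tsum_inner_mul_inner]
    refine tsum_congr fun i => ?_
    simp only [hφ]
    rw [e1, hRsymm, mul_comm]
  have hcomm : ∑' i, ∑' j, φ (i, j) = ∑' j, ∑' i, φ (i, j) :=
    Summable.tsum_comm (f := fun j i => φ (i, j)) hφs.prod_symm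
  have hsum : Summable fun j => ∑' i, φ (i, j) := hφs.prod_symm.prod
  rw [etr, hcomm, Complex.re_tsum hsum]
  refine tsum_nonneg fun j => ?_
  rw [eswap]
  exact ((ContinuousLinearMap.nonneg_iff_isPositive A).1 hA).re_inner_nonneg_left _

end Trace

/-- A positive operator-valued measure on the measurable subsets of `X`: positive and ultraweakly
countably additive. The values on non-measurable sets are irrelevant. -/
structure POVM (X : Type*) [MeasurableSpace X] (K : Type*) [NormedAddCommGroup K]
    [InnerProductSpace ℂ K] [CompleteSpace K] where
  toFun : Set X → (K →L[ℂ] K)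
  nonneg : ∀ E, MeasurableSet E → 0 ≤ toFun E
  hasSum_iUnion : ∀ E : ℕ → Set X, (∀ k, MeasurableSet (E k)) →
    Pairwise (Function.onFun Disjoint E) → ∀ s : K →L[ℂ] K, IsState s →
      HasSum (fun k => tr (s * toFun (E k))) (tr (s * toFun (⋃ k, E k)))

section General

variable {X : Type*} [MeasurableSpace X]
variable {K : Type*} [NormedAddCommGroup K] [InnerProductSpace ℂ K] [CompleteSpace K]

theorem POVM.tr_empty (ν : POVM X K) {s : K →L[ℂ] K} (hs : IsState s) :
    tr (s * ν.toFun ∅) = 0 := by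
  have h := ν.hasSum_iUnion (fun _ => ∅) (fun _ => MeasurableSet.empty)
    (fun _ _ _ => by simp [Function.onFun]) s hs
  exact (summable_const_iff (β := ℕ) _).1 h.summable

/-- The finite positive measure `ν_ρ(E) = tr (ρ ν(E))`. -/
def POVM.scalarMeasure (ν : POVM X K) (ρ : K →L[ℂ] K) (hρ : IsState ρ) : Measure X :=
  Measure.ofMeasurable (fun E _ => ENNReal.ofReal (tr (ρ * ν.toFun E)).re)
    (by simp [ν.tr_empty hρ])
    (by
      intro E hE hd
      have h := Complex.hasSum_re (ν.hasSum_iUnion E hE hd ρ hρ)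
      rw [← h.tsum_eq]
      exact ENNReal.ofReal_tsum_of_nonneg
        (fun k => tr_state_mul_nonneg hρ (ν.nonneg _ (hE k))) h.summable)

theorem POVM.scalarMeasure_apply (ν : POVM X K) (ρ : K →L[ℂ] K) (hρ : IsState ρ) {E : Set X}
    (hE : MeasurableSet E) :
    ν.scalarMeasure ρ hρ E = ENNReal.ofReal (tr (ρ * ν.toFun E)).re :=
  Measure.ofMeasurable_apply E hE

/-- Quantum random variables: `x ↦ tr (s f(x))` is measurable for every state `s`. -/
def IsQRV (f : X → (K →L[ℂ] K)) : Prop :=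
  ∀ s : K →L[ℂ] K, IsState s → Measurable fun x => tr (s * f x)

/-- The space `𝓛_K(X)`: the complex span of the positive quantum random variables. -/
def qrvSpan (X : Type*) [MeasurableSpace X] (K : Type*) [NormedAddCommGroup K]
    [InnerProductSpace ℂ K] [CompleteSpace K] : Submodule ℂ (X → (K →L[ℂ] K)) :=
  Submodule.span ℂ {f | IsQRV f ∧ ∀ x, 0 ≤ f x}

/-- `D` is a version of the Radon-Nikodym derivative `dν/dμ`: a quantum random variable whose
matrix entries are the densities of the matrix entries of `ν`. -/
def IsRNDeriv (ν : POVM X K) (μ : Measure X) (D : X → (K →L[ℂ] K)) : Prop :=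
  IsQRV D ∧ ∀ i j, Integrable (fun x => inner ℂ (onb K i) (D x (onb K j))) μ ∧
    ∀ E, MeasurableSet E → inner ℂ (onb K i) (ν.toFun E (onb K j)) =
      ∫ x in E, inner ℂ (onb K i) (D x (onb K j)) ∂μ

/-- `ν` has a Radon-Nikodym derivative with respect to `μ` with values in the bounded operators. -/
def HasRNDeriv (ν : POVM X K) (μ : Measure X) : Prop :=
  ∃ D : X → (K →L[ℂ] K), IsRNDeriv ν μ D

open Classical in
/-- The Radon-Nikodym derivative `dν/dμ` (and `0` if there is none with bounded values). -/
def rnDeriv (ν : POVM X K) (μ : Measure X) : X → (K →L[ℂ] K) :=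
  if h : HasRNDeriv ν μ then h.choose else 0

/-- `f_s(x) = tr (s (dν/dμ)(x)^{1/2} f(x) (dν/dμ)(x)^{1/2})`. -/
def stateFun (ν : POVM X K) (μ : Measure X) (s : K →L[ℂ] K) (f : X → (K →L[ℂ] K)) (x : X) : ℂ :=
  tr (s * (CFC.sqrt (rnDeriv ν μ x) * f x * CFC.sqrt (rnDeriv ν μ x)))

/-- The set `Pos_f` of 4-tuples of positive elements of `𝓛_K(X)` with
`f = f₁ - f₂ + i f₃ - i f₄`. -/
def posDecomp (f : X → (K →L[ℂ] K)) : Set (Fin 4 → X → (K →L[ℂ] K)) :=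
  {F | (∀ k, F k ∈ qrvSpan X K) ∧ (∀ k x, 0 ≤ F k x) ∧
    f = F 0 - F 1 + Complex.I • F 2 - Complex.I • F 3}

/-- The norm `‖f‖_p`, with values in `[0, ∞]`. -/
def pNorm (ν : POVM X K) (μ : Measure X) (p : ℝ) (f : X → (K →L[ℂ] K)) : ℝ≥0∞ :=
  ⨅ F ∈ posDecomp f, ⨆ (s : K →L[ℂ] K) (_ : IsState s),
    eLpNorm (stateFun ν μ s (F 0 + F 1 + F 2 + F 3)) (ENNReal.ofReal p) μ

/-- The space `𝓛^p_K(X, ν)`. -/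
def lpSpace (ν : POVM X K) (μ : Measure X) (p : ℝ) : Set (X → (K →L[ℂ] K)) :=
  {f | f ∈ qrvSpan X K ∧ pNorm ν μ p f < ∞}

/-- Positivity of the operator matrix `[[S, T], [T*, R]]` on `K ⊕ K`. -/
def BlockPos (S T R : K →L[ℂ] K) : Prop :=
  ∀ u v : K, 0 ≤ inner ℂ u (S u + T v) + inner ℂ v (ContinuousLinearMap.adjoint T u + R v)

/-- The decomposable norm `‖f‖_{p,dec}`. -/
def decNorm (ν : POVM X K) (μ : Measure X) (p : ℝ) (f : X → (K →L[ℂ] K)) : ℝ≥0∞ :=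
  ⨅ (S : X → (K →L[ℂ] K)) (R : X → (K →L[ℂ] K))
    (_ : S ∈ qrvSpan X K ∧ R ∈ qrvSpan X K ∧ (∀ x, 0 ≤ S x) ∧ (∀ x, 0 ≤ R x) ∧
      ∀ᵐ x ∂μ, BlockPos (S x) (f x) (R x)),
    max (pNorm ν μ p S) (pNorm ν μ p R)

end General

section Tensor

variable {X : Type*} [MeasurableSpace X]
variable {H₁ : Type*} [NormedAddCommGroup H₁] [InnerProductSpace ℂ H₁] [CompleteSpace H₁]
variable {H₂ : Type*} [NormedAddCommGroup H₂] [InnerProductSpace ℂ H₂] [CompleteSpace H₂]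

/-- The Hilbert space tensor product. -/
abbrev HTensor (H₁ : Type*) [NormedAddCommGroup H₁] [InnerProductSpace ℂ H₁]
    (H₂ : Type*) [NormedAddCommGroup H₂] [InnerProductSpace ℂ H₂] : Type _ :=
  UniformSpace.Completion (H₁ ⊗[ℂ] H₂)

/-- The tensor product of two bounded operators, as an operator on the Hilbert space tensor
product. -/
def opTensor (A : H₁ →L[ℂ] H₁) (B : H₂ →L[ℂ] H₂) : HTensor H₁ H₂ →L[ℂ] HTensor H₁ H₂ :=
  (TensorProduct.mapL A B).completion

/-- The pointwise tensor product of operator-valued functions. -/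
def funTensor (f : X → (H₁ →L[ℂ] H₁)) (g : X → (H₂ →L[ℂ] H₂)) :
    X → (HTensor H₁ H₂ →L[ℂ] HTensor H₁ H₂) :=
  fun x => opTensor (f x) (g x)

/-- `ν` is the tensor product `ν₁ ⊗_μ ν₂`, i.e.
`ν(E) = ∫_E (dν₁/dμ ⊗ dν₂/dμ) dμ` as an ultraweak integral. -/
def IsTensorPOVM (μ : Measure X) (ν₁ : POVM X H₁) (ν₂ : POVM X H₂) (ν : POVM X (HTensor H₁ H₂)) :
    Prop :=
  ∀ s : HTensor H₁ H₂ →L[ℂ] HTensor H₁ H₂, IsState s →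
    Integrable (fun x => tr (s * opTensor (rnDeriv ν₁ μ x) (rnDeriv ν₂ μ x))) μ ∧
    ∀ E, MeasurableSet E → tr (s * ν.toFun E) =
      ∫ x in E, tr (s * opTensor (rnDeriv ν₁ μ x) (rnDeriv ν₂ μ x)) ∂μ

/-- Separable states: the closure, within the states, of the convex hull of the product states.
On the set of density operators the operator norm, the trace norm and the ultraweak topology
coincide, so it does not matter in which of them the closure is taken. -/
def sepStates (H₁ : Type*) [NormedAddCommGroup H₁] [InnerProductSpace ℂ H₁] [CompleteSpace H₁]
    (H₂ : Type*) [NormedAddCommGroup H₂] [InnerProductSpace ℂ H₂] [CompleteSpace H₂] :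
    Set (HTensor H₁ H₂ →L[ℂ] HTensor H₁ H₂) :=
  {s | IsState s ∧ s ∈ closure (convexHull ℝ {t | ∃ (s₁ : H₁ →L[ℂ] H₁) (s₂ : H₂ →L[ℂ] H₂),
    IsState s₁ ∧ IsState s₂ ∧ t = opTensor s₁ s₂})}

/-- The seminorm `‖F‖_{p,sep,ν}`, where `ν` is a POVM on the tensor product and `μ` the reference
measure. -/
def sepNorm (ν : POVM X (HTensor H₁ H₂)) (μ : Measure X) (p : ℝ)
    (F : X → (HTensor H₁ H₂ →L[ℂ] HTensor H₁ H₂)) : ℝ≥0∞ :=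
  ⨆ s ∈ sepStates H₁ H₂, eLpNorm (stateFun ν μ s F) (ENNReal.ofReal p) μ

/-- The decomposable version `‖F‖_{p,sep,dec}`, where the majorants `S, R` range over the positive
functions in the class `C`. -/
def sepDecNorm (C : Set (X → (HTensor H₁ H₂ →L[ℂ] HTensor H₁ H₂)))
    (ν : POVM X (HTensor H₁ H₂)) (μ : Measure X) (p : ℝ)
    (F : X → (HTensor H₁ H₂ →L[ℂ] HTensor H₁ H₂)) : ℝ≥0∞ :=
  ⨅ (S : X → (HTensor H₁ H₂ →L[ℂ] HTensor H₁ H₂)) (R : X → (HTensor H₁ H₂ →L[ℂ] HTensor H₁ H₂))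
    (_ : S ∈ C ∧ R ∈ C ∧ (∀ x, 0 ≤ S x) ∧ (∀ x, 0 ≤ R x) ∧
      ∀ᵐ x ∂μ, BlockPos (S x) (F x) (R x)),
    max (sepNorm ν μ p S) (sepNorm ν μ p R)

end Tensor

end QRV

end

/-! The product of the two scalar functions is what Hölder's inequality needs, and product states
supply it. Almost everywhere the derivative of the tensor POVM is `D ⊗ D`, and `√(D ⊗ D) = √D ⊗ √D`,
so `(f ⊗ g)_{s₁ ⊗ s₂} = f_{s₁} g_{s₂}` (`IsTensorPOVM.stateFun_product_ae_eq`). Scalar Hölder,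
together with `‖f_s‖_{L^p} ≤ ‖f‖_p` for every state `s`, gives the first bound on product states. It
extends to their convex hull because `s ↦ F_s` is affine and the `L¹` norm is convex, and to the
closure by Fatou's lemma, since norm convergence of states to a state is already ultraweak
convergence (`tendsto_tr_of_tendsto`).

For the decomposable norms, nearly optimal majorants of `f` and `g` are tensored. The resulting
block matrix is positive by Schur's product theorem applied to Gram matrices (`BlockPos.opTensor`),
and the first bound applies to the diagonal entries.

In finite dimension the tensored majorants lie in `L¹`: against an arbitrary, possibly entangled,
state they are dominated by a product of pointwise traces, which are finite sums of `L^p` and `L^q`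
functions.

Separability supplies countable bases, hence measurability of `√D` and of all the functions
involved. -/

noncomputable section

namespace QRV

/-! ### Traces against states: independence of the basis, positivity, ultraweak continuity. -/

section Trace

variable {K : Type*} [NormedAddCommGroup K] [InnerProductSpace ℂ K]
variable {ι κ : Type*}

theorem hasSum_norm_inner_sq_basis (b : HilbertBasis ι ℂ K) (x : K) :
    HasSum (fun i => ‖inner ℂ (b i) x‖ ^ 2) (‖x‖ ^ 2) := by
  have h := Complex.hasSum_re (b.hasSum_inner_mul_inner x x)
  have e : ∀ i, (inner ℂ x (b i) * inner ℂ (b i) x : ℂ).re = ‖inner ℂ (b i) x‖ ^ 2 := by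
    intro i
    rw [← inner_conj_symm x (b i), Complex.conj_mul']
    norm_cast
  have e2 : (inner ℂ x x : ℂ).re = ‖x‖ ^ 2 := by
    rw [inner_self_eq_norm_sq_to_K]; norm_cast
  rw [e2] at h
  simpa only [e] using h

theorem summable_norm_inner_sq_prod (b : HilbertBasis ι ℂ K) {v : κ → K}
    (h : Summable fun k => ‖v k‖ ^ 2) :
    Summable fun q : κ × ι => ‖inner ℂ (b q.2) (v q.1)‖ ^ 2 := by
  refine (summable_prod_of_nonneg fun _ => by positivity).2 ⟨fun k => ?_, ?_⟩
  · exact (hasSum_norm_inner_sq_basis b (v k)).summable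
  · exact h.congr fun k => (hasSum_norm_inner_sq_basis b (v k)).tsum_eq.symm

theorem inner_comm_of_nonneg {A : K →L[ℂ] K} (hA : 0 ≤ A) (x y : K) :
    inner ℂ (A x) y = inner ℂ x (A y) :=
  ((ContinuousLinearMap.nonneg_iff_isPositive A).1 hA).isSymmetric x y

theorem summable_norm_sq_comp {v : ι → K} (h : Summable fun i => ‖v i‖ ^ 2) (A : K →L[ℂ] K) :
    Summable fun i => ‖A (v i)‖ ^ 2 := by
  refine Summable.of_nonneg_of_le (fun _ => by positivity) (fun i => ?_) (h.mul_left (‖A‖ ^ 2))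
  rw [← mul_pow]
  gcongr
  exact A.le_opNorm _

/-- In the order of `ℂ`, `0 ≤ z` includes that `z` is real, and over `ℂ` a real quadratic form
forces self-adjointness. -/
theorem nonneg_iff_inner {A : K →L[ℂ] K} : 0 ≤ A ↔ ∀ x, 0 ≤ inner ℂ x (A x) := by
  rw [ContinuousLinearMap.nonneg_iff_isPositive]
  refine ⟨fun h x => h.inner_nonneg_right x, fun h => ?_⟩
  rw [ContinuousLinearMap.isPositive_iff_complex]
  intro x
  have hx := h x
  rw [Complex.nonneg_iff] at hx
  rw [← inner_conj_symm]
  generalize (inner ℂ x (A x) : ℂ) = z at hx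
  refine ⟨?_, by simpa using hx.1⟩
  apply Complex.ext
  · simp
  · simpa using hx.2.symm

variable [CompleteSpace K]

/-- The Hilbert-Schmidt norm of an operator and of its adjoint agree, in any two bases. -/
theorem hasSum_norm_sq_adjoint (b : HilbertBasis ι ℂ K) (b' : HilbertBasis κ ℂ K)
    (B : K →L[ℂ] K) {c : ℝ} (h : HasSum (fun i => ‖B (b i)‖ ^ 2) c) :
    HasSum (fun j => ‖ContinuousLinearMap.adjoint B (b' j)‖ ^ 2) c := by
  -- Both sums are the double sum of `|⟨b' j, B (b i)⟩|²`, taken by rows or by columns.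
  have hs := summable_norm_inner_sq_prod b' (v := fun i => B (b i)) h.summable
  have h1 := hs.hasSum.prod_fiberwise fun i => hasSum_norm_inner_sq_basis b' (B (b i))
  have h2 : HasSum (fun q : κ × ι => ‖inner ℂ (b' q.1) (B (b q.2))‖ ^ 2) c := by
    rw [← h1.unique h]
    exact (Equiv.prodComm κ ι).hasSum_iff.2 hs.hasSum
  refine h2.prod_fiberwise fun j => ?_
  have e : ∀ i, ‖inner ℂ (b' j) (B (b i))‖ =
      ‖inner ℂ (b i) (ContinuousLinearMap.adjoint B (b' j))‖ := fun i => by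
    rw [← ContinuousLinearMap.adjoint_inner_left, norm_inner_symm]
  simp only [e]
  exact hasSum_norm_inner_sq_basis b _

theorem adjoint_eq_self_of_nonneg {A : K →L[ℂ] K} (hA : 0 ≤ A) :
    ContinuousLinearMap.adjoint A = A :=
  (IsSelfAdjoint.of_nonneg hA).star_eq

/-- The positive square root of a positive operator. -/
def opSqrt (A : K →L[ℂ] K) : K →L[ℂ] K := CFC.sqrt A

theorem opSqrt_nonneg (A : K →L[ℂ] K) : 0 ≤ opSqrt A := CFC.sqrt_nonneg A

theorem opSqrt_mul_opSqrt {A : K →L[ℂ] K} (hA : 0 ≤ A) : opSqrt A * opSqrt A = A :=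
  CFC.sqrt_mul_sqrt_self A hA

theorem opSqrt_unique {A B : K →L[ℂ] K} (h : B * B = A) (hB : 0 ≤ B) : opSqrt A = B :=
  CFC.sqrt_unique h hB

theorem opSqrt_mul_self {A : K →L[ℂ] K} (hA : 0 ≤ A) : opSqrt (A * A) = A :=
  opSqrt_unique rfl hA

theorem adjoint_mul_self_nonneg (T : K →L[ℂ] K) : 0 ≤ ContinuousLinearMap.adjoint T * T :=
  star_mul_self_nonneg T

theorem opSqrt_opSqrt_apply {s : K →L[ℂ] K} (hs : 0 ≤ s) (x : K) :
    opSqrt s (opSqrt s x) = s x := by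
  conv_rhs => rw [← opSqrt_mul_opSqrt hs]
  rfl

theorem inner_apply_eq_inner_sqrt {s : K →L[ℂ] K} (hs : 0 ≤ s) (x y : K) :
    inner ℂ x (s y) = inner ℂ (opSqrt s x) (opSqrt s y) := by
  rw [← opSqrt_opSqrt_apply hs, inner_comm_of_nonneg (opSqrt_nonneg s)]

theorem inner_self_eq_norm_sqrt_sq {s : K →L[ℂ] K} (hs : 0 ≤ s) (x : K) :
    inner ℂ x (s x) = ((‖opSqrt s x‖ ^ 2 : ℝ) : ℂ) := by
  rw [inner_apply_eq_inner_sqrt hs, inner_self_eq_norm_sq_to_K]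
  norm_cast

/-- The square root of a state has Hilbert-Schmidt norm one. -/
theorem IsState.hasSum_norm_sqrt_sq {s : K →L[ℂ] K} (hs : IsState s) (b : HilbertBasis ι ℂ K) :
    HasSum (fun i => ‖opSqrt s (b i)‖ ^ 2) 1 := by
  have h : HasSum (fun i => ‖opSqrt s (onb K i)‖ ^ 2) 1 := by
    have h := hs.2
    simp only [inner_self_eq_norm_sqrt_sq hs.1] at h
    rwa [← Complex.ofReal_one, Complex.hasSum_ofReal] at h
  have := hasSum_norm_sq_adjoint (onb K) b _ h
  rwa [adjoint_eq_self_of_nonneg (opSqrt_nonneg s)] at this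

/-- A positive square root of Hilbert-Schmidt norm one, in any basis, gives a state. -/
theorem isState_of_hasSum_norm_sq {R : K →L[ℂ] K} (hR : 0 ≤ R) (b : HilbertBasis ι ℂ K)
    (h : HasSum (fun i => ‖R (b i)‖ ^ 2) 1) : IsState (R * R) := by
  have h0 : 0 ≤ R * R := by
    rw [nonneg_iff_inner]
    intro x
    rw [mul_apply_eq_comp, ← inner_comm_of_nonneg hR, inner_self_eq_norm_sq_to_K]
    norm_cast
    positivity
  refine ⟨h0, ?_⟩
  have h1 := hasSum_norm_sq_adjoint b (onb K) _ h
  rw [adjoint_eq_self_of_nonneg hR] at h1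
  simp only [inner_self_eq_norm_sqrt_sq h0, opSqrt_mul_self hR]
  rwa [← Complex.ofReal_one, Complex.hasSum_ofReal]

/-- If `R ≥ 0` is Hilbert-Schmidt, then `∑ ⟨R b i, R A b i⟩` converges and equals
`∑ ⟨R b' j, A R b' j⟩`. -/
theorem exists_hasSum_of_hilbertSchmidt {R : K →L[ℂ] K} (hR0 : 0 ≤ R) (A : K →L[ℂ] K)
    (b : HilbertBasis ι ℂ K) (b' : HilbertBasis κ ℂ K)
    (hb : Summable fun i => ‖R (b i)‖ ^ 2) (hb' : Summable fun i => ‖R (b' i)‖ ^ 2) :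
    ∃ c : ℂ, HasSum (fun i => inner ℂ (R (b i)) (R (A (b i)))) c ∧
      HasSum (fun j => inner ℂ (R (b' j)) (A (R (b' j)))) c := by
  have h1 : Summable fun q : ι × κ => ‖inner ℂ (b' q.2) (R (b q.1))‖ ^ 2 :=
    summable_norm_inner_sq_prod b' (v := fun i => R (b i)) hb
  have h2 : Summable fun q : κ × ι =>
      ‖inner ℂ (b q.2) (ContinuousLinearMap.adjoint A (R (b' q.1)))‖ ^ 2 := by
    have h := summable_norm_sq_comp hb' (ContinuousLinearMap.adjoint A)
    exact summable_norm_inner_sq_prod b (v := fun j => ContinuousLinearMap.adjoint A (R (b' j))) h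
  have e1 : ∀ i j, inner ℂ (b' j) (R (A (b i))) =
      inner ℂ (ContinuousLinearMap.adjoint A (R (b' j))) (b i) := fun i j => by
    rw [← inner_comm_of_nonneg hR0, ContinuousLinearMap.adjoint_inner_left]
  -- Each term is a product of entries of two Hilbert-Schmidt operators, so the double family
  -- converges absolutely and may be summed in either order.
  have hφs : Summable fun q : ι × κ =>
      inner ℂ (R (b q.1)) (b' q.2) * inner ℂ (b' q.2) (R (A (b q.1))) := by
    refine Summable.of_norm_bounded (h1.add h2.prod_symm) fun q => ?_
    simp only [Prod.fst_swap, Prod.snd_swap, norm_mul]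
    rw [e1, norm_inner_symm (R (b q.1)),
      norm_inner_symm (ContinuousLinearMap.adjoint A (R (b' q.2)))]
    have key : ∀ x y : ℝ, x * y ≤ x ^ 2 + y ^ 2 := fun x y => by
      nlinarith [sq_nonneg (x - y), sq_nonneg x, sq_nonneg y]
    exact key _ _
  obtain ⟨c, hc⟩ := hφs
  refine ⟨c, ?_, ?_⟩
  · exact hc.prod_fiberwise fun i => b'.hasSum_inner_mul_inner (R (b i)) (R (A (b i)))
  · have h3 := (Equiv.prodComm κ ι).hasSum_iff.2 hc
    refine h3.prod_fiberwise fun j => ?_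
    have h4 := b.hasSum_inner_mul_inner (ContinuousLinearMap.adjoint A (R (b' j))) (R (b' j))
    rw [ContinuousLinearMap.adjoint_inner_left] at h4
    refine h4.congr_fun fun i => ?_
    simp only [Function.comp_apply, Equiv.prodComm_apply, Prod.fst_swap, Prod.snd_swap]
    rw [e1, inner_comm_of_nonneg hR0, mul_comm]

theorem IsState.exists_hasSum {s : K →L[ℂ] K} (hs : IsState s) (A : K →L[ℂ] K)
    (b : HilbertBasis ι ℂ K) (b' : HilbertBasis κ ℂ K) :
    ∃ c : ℂ, HasSum (fun i => inner ℂ (b i) (s (A (b i)))) c ∧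
      HasSum (fun j => inner ℂ (opSqrt s (b' j)) (A (opSqrt s (b' j)))) c := by
  simp only [inner_apply_eq_inner_sqrt hs.1]
  exact exists_hasSum_of_hilbertSchmidt (opSqrt_nonneg s) A b b'
    (hs.hasSum_norm_sqrt_sq b).summable (hs.hasSum_norm_sqrt_sq b').summable

theorem IsState.hasSum_tr {s : K →L[ℂ] K} (hs : IsState s) (A : K →L[ℂ] K) :
    HasSum (fun i => inner ℂ (onb K i) (s (A (onb K i)))) (tr (s * A)) := by
  obtain ⟨c, h, -⟩ := hs.exists_hasSum A (onb K) (onb K)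
  exact h.summable.hasSum

/-- `tr` is tied to the fixed basis `onb`; here the basis is arbitrary, which later allows product
bases, and the symmetric form makes positivity visible. -/
theorem IsState.hasSum_tr_sqrt {s : K →L[ℂ] K} (hs : IsState s) (A : K →L[ℂ] K)
    (b : HilbertBasis ι ℂ K) :
    HasSum (fun j => inner ℂ (opSqrt s (b j)) (A (opSqrt s (b j)))) (tr (s * A)) := by
  obtain ⟨c, h, h'⟩ := hs.exists_hasSum A (onb K) b
  rwa [(hs.hasSum_tr A).unique h]

theorem IsState.tr_add {s : K →L[ℂ] K} (hs : IsState s) (A B : K →L[ℂ] K) :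
    tr (s * (A + B)) = tr (s * A) + tr (s * B) := by
  refine (hs.hasSum_tr _).unique ?_
  simpa [inner_add_right] using (hs.hasSum_tr A).add (hs.hasSum_tr B)

theorem IsState.tr_smul {s : K →L[ℂ] K} (hs : IsState s) (c : ℂ) (A : K →L[ℂ] K) :
    tr (s * (c • A)) = c * tr (s * A) := by
  refine (hs.hasSum_tr _).unique ?_
  simpa [inner_smul_right] using (hs.hasSum_tr A).mul_left c

theorem IsState.tr_nonneg {s A : K →L[ℂ] K} (hs : IsState s) (hA : 0 ≤ A) :
    0 ≤ tr (s * A) := by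
  refine (hs.hasSum_tr_sqrt A (onb K)).nonneg fun j => ?_
  exact nonneg_iff_inner.1 hA _

theorem IsState.norm_tr_le {s : K →L[ℂ] K} (hs : IsState s) (A : K →L[ℂ] K) :
    ‖tr (s * A)‖ ≤ ‖A‖ := by
  have h1 := (hs.hasSum_norm_sqrt_sq (onb K)).mul_left ‖A‖
  rw [mul_one] at h1
  rw [← (hs.hasSum_tr_sqrt A (onb K)).tsum_eq]
  refine tsum_of_norm_bounded h1 fun i => ?_
  refine (norm_inner_le_norm _ _).trans ?_
  have := A.le_opNorm (opSqrt s (onb K i))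
  nlinarith [norm_nonneg (opSqrt s (onb K i))]

theorem convex_isState : Convex ℝ {s : K →L[ℂ] K | IsState s} := by
  intro s hs t ht a b ha hb hab
  refine ⟨add_nonneg (smul_nonneg ha hs.1) (smul_nonneg hb ht.1), ?_⟩
  have h := (hs.2.mul_left (a : ℂ)).add (ht.2.mul_left (b : ℂ))
  have e : (a : ℂ) * 1 + b * 1 = 1 := by rw [mul_one, mul_one]; exact_mod_cast hab
  rw [e] at h
  refine h.congr_fun fun i => ?_
  simp

theorem tr_convex_comb {s t : K →L[ℂ] K} (hs : IsState s) (ht : IsState t) {a b : ℝ}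
    (ha : 0 ≤ a) (hb : 0 ≤ b) (hab : a + b = 1) (A : K →L[ℂ] K) :
    tr ((a • s + b • t) * A) = a * tr (s * A) + b * tr (t * A) := by
  refine ((convex_isState hs ht ha hb hab).hasSum_tr A).unique ?_
  refine (((hs.hasSum_tr A).mul_left (a : ℂ)).add ((ht.hasSum_tr A).mul_left (b : ℂ))).congr_fun ?_
  intro i
  simp

theorem hasSum_indicator_compl {E : Type*} [NormedAddCommGroup E] {f : ι → E} {a : E}
    (h : HasSum f a) (F : Finset ι) :
    HasSum (Set.indicator (F : Set ι)ᶜ f) (a - ∑ i ∈ F, f i) := by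
  have h1 : HasSum (Set.indicator (F : Set ι) f) (∑ i ∈ F, f i) := by
    have := hasSum_sum_of_ne_finset_zero (f := Set.indicator (F : Set ι) f) (s := F)
      (L := SummationFilter.unconditional ι)
      (fun i hi => Set.indicator_of_notMem (by simpa using hi) _)
    rwa [Finset.sum_congr rfl (g := f)
      (fun i hi => Set.indicator_of_mem (by simpa using hi) _)] at this
  rw [Set.indicator_compl]
  exact h.sub h1

/-- `√s A` is the adjoint of `A* √s`, whose Hilbert-Schmidt norm is at most `‖A‖` because that of
`√s` is one. -/
theorem IsState.norm_sq_sqrt_comp_le {s : K →L[ℂ] K} (hs : IsState s) (A : K →L[ℂ] K)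
    (b : HilbertBasis ι ℂ K) :
    ∃ c ≤ ‖A‖ ^ 2, HasSum (fun i => ‖opSqrt s (A (b i))‖ ^ 2) c := by
  obtain ⟨c, hc⟩ := summable_norm_sq_comp (hs.hasSum_norm_sqrt_sq b).summable
    (ContinuousLinearMap.adjoint A)
  refine ⟨c, ?_, ?_⟩
  · have h1 := (hs.hasSum_norm_sqrt_sq b).mul_left (‖A‖ ^ 2)
    rw [mul_one] at h1
    refine hasSum_le (fun i => ?_) hc h1
    rw [← mul_pow, ← ContinuousLinearMap.adjoint.norm_map A]
    gcongr
    exact ContinuousLinearMap.le_opNorm _ _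
  · have h := hasSum_norm_sq_adjoint b b (ContinuousLinearMap.adjoint A * opSqrt s) hc
    refine h.congr_fun fun i => ?_
    rw [ContinuousLinearMap.mul_def, ContinuousLinearMap.adjoint_comp,
      adjoint_eq_self_of_nonneg (opSqrt_nonneg s), ContinuousLinearMap.adjoint_adjoint]
    rfl

/-- Tail estimate for the trace. -/
theorem IsState.norm_tr_sub_sum_le {s : K →L[ℂ] K} (hs : IsState s) (A : K →L[ℂ] K)
    (F : Finset (onbIndex K)) {δ : ℝ} (hδ : 0 < δ) :
    ‖tr (s * A) - ∑ i ∈ F, inner ℂ (onb K i) (s (A (onb K i)))‖ ≤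
      δ⁻¹ * (1 - ∑ i ∈ F, (inner ℂ (onb K i) (s (onb K i)) : ℂ).re) + δ * ‖A‖ ^ 2 := by
  obtain ⟨c, hc, hsum⟩ := hs.norm_sq_sqrt_comp_le A (onb K)
  have h1 := hasSum_indicator_compl (hs.hasSum_norm_sqrt_sq (onb K)) F
  have e : ∀ i, (inner ℂ (onb K i) (s (onb K i)) : ℂ).re = ‖opSqrt s (onb K i)‖ ^ 2 :=
    fun i => by rw [inner_self_eq_norm_sqrt_sq hs.1, Complex.ofReal_re]
  simp only [e]
  have h2 := (h1.mul_left δ⁻¹).add (hsum.mul_left δ)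
  have h3 := hasSum_indicator_compl (hs.hasSum_tr A) F
  rw [← h3.tsum_eq]
  refine (tsum_of_norm_bounded h2 fun i => ?_).trans (by gcongr)
  by_cases hi : i ∈ ((F : Set (onbIndex K))ᶜ)
  · rw [Set.indicator_of_mem hi, Set.indicator_of_mem hi, inner_apply_eq_inner_sqrt hs.1]
    refine (norm_inner_le_norm _ _).trans ?_
    -- The weight `δ` stays free: it first makes the `‖A‖²` term small, and the tail mass of the
    -- state then has to beat `δ⁻¹`.
    have key : ∀ x y : ℝ, x * y ≤ δ⁻¹ * x ^ 2 + δ * y ^ 2 := fun x y => by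
      have h4 : 0 ≤ δ⁻¹ * (x - δ * y) ^ 2 := by positivity
      have h5 : δ⁻¹ * (x - δ * y) ^ 2 = δ⁻¹ * x ^ 2 + δ * y ^ 2 - 2 * (x * y) := by
        field_simp; ring
      have h6 : 0 ≤ δ⁻¹ * x ^ 2 := by positivity
      have h7 : 0 ≤ δ * y ^ 2 := by positivity
      linarith
    exact key _ _
  · rw [Set.indicator_of_notMem hi, Set.indicator_of_notMem hi, norm_zero]
    positivity

/-- On states, convergence in operator norm implies ultraweak convergence. -/
theorem tendsto_tr_of_tendsto {s : ℕ → K →L[ℂ] K} {t : K →L[ℂ] K} (hs : ∀ n, IsState (s n))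
    (ht : IsState t) (hst : Filter.Tendsto s Filter.atTop (nhds t)) (A : K →L[ℂ] K) :
    Filter.Tendsto (fun n => tr (s n * A)) Filter.atTop (nhds (tr (t * A))) := by
  have hin : ∀ x y : K, Filter.Tendsto (fun n => inner ℂ x (s n y)) Filter.atTop
      (nhds (inner ℂ x (t y))) := fun x y =>
    tendsto_const_nhds.inner (((ContinuousLinearMap.apply ℂ K y).continuous.tendsto t).comp hst)
  rw [Metric.tendsto_nhds]
  intro ε hε
  obtain ⟨δ, hδ, hδε⟩ : ∃ δ : ℝ, 0 < δ ∧ δ * ‖A‖ ^ 2 ≤ ε / 8 := by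
    refine ⟨ε / 8 / (‖A‖ ^ 2 + 1), by positivity, ?_⟩
    rw [div_mul_eq_mul_div, div_le_iff₀ (by positivity)]
    nlinarith [sq_nonneg ‖A‖]
  have htr := Complex.hasSum_re ht.2
  have hpos : (1 : ℝ) - (1 : ℂ).re < δ * (ε / 8) := by
    rw [Complex.one_re, sub_self]; positivity
  obtain ⟨F, hF⟩ := (((tendsto_const_nhds (x := (1 : ℝ))).sub htr).eventually_lt_const hpos).exists
  -- No mass escapes: every state has trace one, so convergence of the finitely many diagonal
  -- entries in `F` makes the tails of `s n` eventually as small as that of `t`.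
  have hF2 := ((tendsto_const_nhds (x := (1 : ℝ))).sub (tendsto_finsetSum F fun i _ =>
    (Complex.continuous_re.tendsto _).comp (hin (onb K i) (onb K i)))).eventually_lt_const hF
  have hF3 := Metric.tendsto_nhds.1
    (tendsto_finsetSum F fun i _ => hin (onb K i) (A (onb K i))) (ε / 4) (by positivity)
  filter_upwards [hF2, hF3] with n h2 h3
  have h4 := (hs n).norm_tr_sub_sum_le A F hδ
  have h5 := ht.norm_tr_sub_sum_le A F hδ
  have h6 : ∀ y, y < δ * (ε / 8) → δ⁻¹ * y ≤ ε / 8 := fun y hy => by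
    rw [inv_mul_le_iff₀ hδ]; exact hy.le
  have h7 := h6 _ h2
  have h8 := h6 _ hF
  simp only [Function.comp_def] at h7
  rw [dist_eq_norm] at h3 ⊢
  set a := tr (s n * A)
  set b := tr (t * A)
  set a' := ∑ i ∈ F, inner ℂ (onb K i) (s n (A (onb K i)))
  set b' := ∑ i ∈ F, inner ℂ (onb K i) (t (A (onb K i)))
  calc ‖a - b‖ = ‖(a - a') + (a' - b') - (b - b')‖ := by congr 1; ring
    _ ≤ ‖a - a'‖ + ‖a' - b'‖ + ‖b - b'‖ :=
      (norm_sub_le _ _).trans (by gcongr; exact norm_add_le _ _)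
    _ < ε := by linarith

end Trace

/-! ### Hilbert space tensor products of vectors, bases, operators and states. -/

section Tensor

variable {H₁ : Type*} [NormedAddCommGroup H₁] [InnerProductSpace ℂ H₁]
variable {H₂ : Type*} [NormedAddCommGroup H₂] [InnerProductSpace ℂ H₂]

/-- Elementary tensors in the Hilbert space tensor product. -/
def htmul (x : H₁) (y : H₂) : HTensor H₁ H₂ := ((x ⊗ₜ[ℂ] y : H₁ ⊗[ℂ] H₂) : HTensor H₁ H₂)

theorem inner_htmul (x x' : H₁) (y y' : H₂) :
    inner ℂ (htmul x y) (htmul x' y') = inner ℂ x x' * inner ℂ y y' := by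
  rw [htmul, htmul, UniformSpace.Completion.inner_coe, TensorProduct.inner_tmul]

theorem norm_htmul (x : H₁) (y : H₂) : ‖htmul x y‖ = ‖x‖ * ‖y‖ := by
  rw [htmul, UniformSpace.Completion.norm_coe, TensorProduct.norm_tmul]

theorem continuous_htmul : Continuous fun q : H₁ × H₂ => htmul q.1 q.2 :=
  (UniformSpace.Completion.continuous_coe _).comp TensorProduct.continuous_tmul

/-- Every algebraic tensor is a finite sum of elementary tensors. -/
theorem exists_coe_eq_sum_htmul (t : H₁ ⊗[ℂ] H₂) :
    ∃ (n : ℕ) (x : Fin n → H₁) (y : Fin n → H₂), (t : HTensor H₁ H₂) = ∑ i, htmul (x i) (y i) := by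
  induction t using TensorProduct.induction_on with
  | zero => exact ⟨0, Fin.elim0, Fin.elim0, by simp⟩
  | tmul x y => exact ⟨1, fun _ => x, fun _ => y, by simp [htmul]⟩
  | add t u ht hu =>
    obtain ⟨n, x, y, h⟩ := ht
    obtain ⟨m, x', y', h'⟩ := hu
    refine ⟨n + m, Fin.append x x', Fin.append y y', ?_⟩
    rw [UniformSpace.Completion.coe_add, h, h', Fin.sum_univ_add]
    simp

theorem dense_span_htmul :
    Dense (Submodule.span ℂ (Set.range fun q : H₁ × H₂ => htmul q.1 q.2) :
      Set (HTensor H₁ H₂)) := by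
  refine (UniformSpace.Completion.denseRange_coe (α := H₁ ⊗[ℂ] H₂)).mono ?_
  rintro _ ⟨t, rfl⟩
  obtain ⟨n, x, y, h⟩ := exists_coe_eq_sum_htmul t
  rw [h]
  exact Submodule.sum_mem _ fun i _ => Submodule.subset_span ⟨(x i, y i), rfl⟩

theorem ext_htmul {E : Type*} [NormedAddCommGroup E] [NormedSpace ℂ E]
    {A B : HTensor H₁ H₂ →L[ℂ] E} (h : ∀ x y, A (htmul x y) = B (htmul x y)) : A = B :=
  ContinuousLinearMap.ext_on dense_span_htmul (by rintro _ ⟨q, rfl⟩; exact h _ _)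

theorem opTensor_htmul (A : H₁ →L[ℂ] H₁) (B : H₂ →L[ℂ] H₂) (x : H₁) (y : H₂) :
    opTensor A B (htmul x y) = htmul (A x) (B y) := by
  rw [htmul, opTensor, ContinuousLinearMap.completion_apply_coe, TensorProduct.mapL_tmul]
  rfl

theorem opTensor_mul (A A' : H₁ →L[ℂ] H₁) (B B' : H₂ →L[ℂ] H₂) :
    opTensor A B * opTensor A' B' = opTensor (A * A') (B * B') :=
  ext_htmul fun x y => by simp only [mul_apply_eq_comp, opTensor_htmul]

theorem norm_opTensor_le (A : H₁ →L[ℂ] H₁) (B : H₂ →L[ℂ] H₂) : ‖opTensor A B‖ ≤ ‖A‖ * ‖B‖ := by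
  refine ContinuousLinearMap.opNorm_le_bound _ (by positivity) fun z => ?_
  induction z using UniformSpace.Completion.induction_on with
  | hp => exact isClosed_le (by fun_prop) (by fun_prop)
  | ih t =>
    rw [opTensor, ContinuousLinearMap.completion_apply_coe, UniformSpace.Completion.norm_coe,
      UniformSpace.Completion.norm_coe]
    refine (ContinuousLinearMap.le_opNorm _ t).trans ?_
    gcongr
    exact TensorProduct.norm_mapL_le A B

/-- The product of two Hilbert bases. -/
def tensorBasis {ι κ : Type*} [CompleteSpace H₁] [CompleteSpace H₂]
    (b : HilbertBasis ι ℂ H₁) (c : HilbertBasis κ ℂ H₂) :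
    HilbertBasis (ι × κ) ℂ (HTensor H₁ H₂) :=
  HilbertBasis.mk (v := fun q : ι × κ => htmul (b q.1) (c q.2)) (by
    classical
    rw [orthonormal_iff_ite]
    rintro ⟨i, j⟩ ⟨i', j'⟩
    rw [inner_htmul, orthonormal_iff_ite.1 b.orthonormal, orthonormal_iff_ite.1 c.orthonormal]
    simp only [Prod.mk.injEq]
    by_cases h : i = i' <;> by_cases h' : j = j' <;> simp [h, h']) (by
    set V := (Submodule.span ℂ (Set.range fun q : ι × κ => htmul (b q.1) (c q.2))).topologicalClosure
    have hV : IsClosed (V : Set (HTensor H₁ H₂)) := Submodule.isClosed_topologicalClosure _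
    -- Totality is proved one factor at a time: the first factor is freed against each `c j`, then
    -- the second.
    have hx : ∀ j, ∀ x : H₁, htmul x (c j) ∈ V := by
      intro j x
      let T : H₁ →L[ℂ] HTensor H₁ H₂ :=
        UniformSpace.Completion.toComplL.comp ((TensorProduct.mkL ℂ H₁ H₂).flip (c j))
      have : (⊤ : Submodule ℂ H₁) ≤ V.comap T.toLinearMap := by
        rw [← b.dense_span]
        refine Submodule.topologicalClosure_minimal _ ?_ (hV.preimage T.continuous)
        rw [Submodule.span_le]
        rintro _ ⟨i, rfl⟩
        exact subset_closure (Submodule.subset_span ⟨(i, j), rfl⟩)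
      exact this (Submodule.mem_top (x := x))
    have hxy : ∀ (x : H₁) (y : H₂), htmul x y ∈ V := by
      intro x y
      let T : H₂ →L[ℂ] HTensor H₁ H₂ :=
        UniformSpace.Completion.toComplL.comp (TensorProduct.mkL ℂ H₁ H₂ x)
      have : (⊤ : Submodule ℂ H₂) ≤ V.comap T.toLinearMap := by
        rw [← c.dense_span]
        refine Submodule.topologicalClosure_minimal _ ?_ (hV.preimage T.continuous)
        rw [Submodule.span_le]
        rintro _ ⟨j, rfl⟩
        exact hx j x
      exact this (Submodule.mem_top (x := y))
    rw [← (Submodule.dense_iff_topologicalClosure_eq_top.1 (dense_span_htmul (H₁ := H₁) (H₂ := H₂)))]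
    refine Submodule.topologicalClosure_minimal _ ?_ hV
    rw [Submodule.span_le]
    rintro _ ⟨q, rfl⟩
    exact hxy _ _)

variable [CompleteSpace H₁] [CompleteSpace H₂]

theorem tensorBasis_apply {ι κ : Type*} (b : HilbertBasis ι ℂ H₁) (c : HilbertBasis κ ℂ H₂)
    (q : ι × κ) : tensorBasis b c q = htmul (b q.1) (c q.2) := by
  rw [tensorBasis, HilbertBasis.coe_mk]

theorem adjoint_opTensor (A : H₁ →L[ℂ] H₁) (B : H₂ →L[ℂ] H₂) :
    ContinuousLinearMap.adjoint (opTensor A B) =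
      opTensor (ContinuousLinearMap.adjoint A) (ContinuousLinearMap.adjoint B) := by
  refine ext_htmul fun x y => ?_
  refine ext_inner_right ℂ fun z => ?_
  have : (innerSL ℂ (ContinuousLinearMap.adjoint (opTensor A B) (htmul x y))) =
      innerSL ℂ (opTensor (ContinuousLinearMap.adjoint A) (ContinuousLinearMap.adjoint B)
        (htmul x y)) := ext_htmul fun x' y' => by
    rw [innerSL_apply_apply, innerSL_apply_apply, ContinuousLinearMap.adjoint_inner_left,
      opTensor_htmul, opTensor_htmul, inner_htmul, inner_htmul,
      ContinuousLinearMap.adjoint_inner_left, ContinuousLinearMap.adjoint_inner_left]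
  exact DFunLike.congr_fun this z

/-- `A ⊗ B = (√A ⊗ √B)* (√A ⊗ √B)`. -/
theorem opTensor_nonneg {A : H₁ →L[ℂ] H₁} {B : H₂ →L[ℂ] H₂} (hA : 0 ≤ A) (hB : 0 ≤ B) :
    0 ≤ opTensor A B := by
  have h : ContinuousLinearMap.adjoint (opTensor (opSqrt A) (opSqrt B)) * opTensor (opSqrt A) (opSqrt B) =
      opTensor A B := by
    rw [adjoint_opTensor,
      adjoint_eq_self_of_nonneg (opSqrt_nonneg A), adjoint_eq_self_of_nonneg (opSqrt_nonneg B),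
      opTensor_mul, opSqrt_mul_opSqrt hA, opSqrt_mul_opSqrt hB]
  rw [← h]
  exact adjoint_mul_self_nonneg _

theorem opSqrt_opTensor {A : H₁ →L[ℂ] H₁} {B : H₂ →L[ℂ] H₂} (hA : 0 ≤ A) (hB : 0 ≤ B) :
    opSqrt (opTensor A B) = opTensor (opSqrt A) (opSqrt B) :=
  opSqrt_unique (by
    rw [opTensor_mul, opSqrt_mul_opSqrt hA, opSqrt_mul_opSqrt hB])
    (opTensor_nonneg (opSqrt_nonneg A) (opSqrt_nonneg B))

/-- The Hilbert-Schmidt norm of `√s ⊗ √t` factorises in the product basis, and it does not depend on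
the basis. -/
theorem IsState.opTensor {s : H₁ →L[ℂ] H₁} {t : H₂ →L[ℂ] H₂} (hs : IsState s) (ht : IsState t) :
    IsState (opTensor s t) := by
  have h := isState_of_hasSum_norm_sq
    (opTensor_nonneg (opSqrt_nonneg s) (opSqrt_nonneg t)) (tensorBasis (onb H₁) (onb H₂)) (by
      simp only [tensorBasis_apply, opTensor_htmul, norm_htmul, mul_pow]
      have h1 := hs.hasSum_norm_sqrt_sq (onb H₁)
      have h2 := ht.hasSum_norm_sqrt_sq (onb H₂)
      have h3 := h1.mul h2 (h1.summable.mul_of_nonneg h2.summable (fun _ => by positivity)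
        fun _ => by positivity)
      rwa [mul_one] at h3)
  rwa [opTensor_mul, opSqrt_mul_opSqrt hs.1, opSqrt_mul_opSqrt ht.1] at h

theorem hasSum_mul_complex {ι κ : Type*} {f : ι → ℂ} {g : κ → ℂ} {a c : ℂ} (hf : HasSum f a)
    (hg : HasSum g c) : HasSum (fun q : ι × κ => f q.1 * g q.2) (a * c) :=
  hf.mul hg (summable_mul_of_summable_norm hf.summable.norm hg.summable.norm)

theorem tr_opTensor_mul {s : H₁ →L[ℂ] H₁} {t : H₂ →L[ℂ] H₂} (hs : IsState s) (ht : IsState t)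
    (A : H₁ →L[ℂ] H₁) (B : H₂ →L[ℂ] H₂) :
    tr (opTensor s t * opTensor A B) = tr (s * A) * tr (t * B) := by
  have h := (hs.opTensor ht).hasSum_tr_sqrt (QRV.opTensor A B) (tensorBasis (onb H₁) (onb H₂))
  simp only [tensorBasis_apply, opSqrt_opTensor hs.1 ht.1, opTensor_htmul, inner_htmul] at h
  have h1 := hs.hasSum_tr_sqrt A (onb H₁)
  have h2 := ht.hasSum_tr_sqrt B (onb H₂)
  have h3 := hasSum_mul_complex h1 h2
  exact h.unique h3

instance [TopologicalSpace.SeparableSpace H₁] [TopologicalSpace.SeparableSpace H₂] :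
    TopologicalSpace.SeparableSpace (HTensor H₁ H₂) := by
  have h1 : TopologicalSpace.IsSeparable (Set.range fun q : H₁ × H₂ => htmul q.1 q.2) :=
    TopologicalSpace.isSeparable_range continuous_htmul
  have h2 := (h1.span (R := ℂ)).closure
  rw [dense_span_htmul.closure_eq, TopologicalSpace.isSeparable_univ_iff] at h2
  exact h2

instance countable_onbIndex {K : Type*} [NormedAddCommGroup K] [InnerProductSpace ℂ K]
    [CompleteSpace K] [TopologicalSpace.SeparableSpace K] : Countable (onbIndex K) := by
  -- Distinct basis vectors are at distance `√2 ≥ 1`, so balls of radius `1/2` around them are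
  -- disjoint; a separable space holds only countably many.
  refine Pairwise.countable_of_isOpen_disjoint (s := fun i => Metric.ball (onb K i) (1 / 2))
    (fun i j hij => Metric.ball_disjoint_ball ?_) (fun _ => Metric.isOpen_ball)
    (fun i => ⟨onb K i, Metric.mem_ball_self (by norm_num)⟩)
  have h0 := (onb K).orthonormal.2 hij
  have h1 := norm_sub_sq (𝕜 := ℂ) (onb K i) (onb K j)
  rw [h0, (onb K).orthonormal.1 i, (onb K).orthonormal.1 j] at h1
  rw [dist_eq_norm]
  simp only [map_zero] at h1
  nlinarith [norm_nonneg (onb K i - onb K j)]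

end Tensor

/-! ### Vector states, which recover quadratic forms from traces. -/

section VectorStates

variable {K : Type*} [NormedAddCommGroup K] [InnerProductSpace ℂ K] [CompleteSpace K]

theorem isState_rankOne {u : K} (hu : ‖u‖ = 1) : IsState (InnerProductSpace.rankOne ℂ u u) := by
  refine ⟨nonneg_iff_inner.2 fun x => ?_, ?_⟩
  · rw [InnerProductSpace.rankOne_apply, inner_smul_right, ← inner_conj_symm, Complex.conj_mul']
    norm_cast
    positivity
  · have h := (onb K).hasSum_inner_mul_inner u u
    rw [inner_self_eq_norm_sq_to_K, hu] at h
    simpa [InnerProductSpace.rankOne_apply, inner_smul_right] using h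

theorem tr_rankOne_mul {u : K} (hu : ‖u‖ = 1) (A : K →L[ℂ] K) :
    tr (InnerProductSpace.rankOne ℂ u u * A) = inner ℂ u (A u) := by
  refine ((isState_rankOne hu).hasSum_tr A).unique ?_
  have h := (onb K).hasSum_inner_mul_inner (ContinuousLinearMap.adjoint A u) u
  simp only [ContinuousLinearMap.adjoint_inner_left] at h
  simpa [InnerProductSpace.rankOne_apply, inner_smul_right] using h

end VectorStates

/-! ### Weak measurability and its stability under products, square roots and tensor products. -/

section WeakMeasurability

variable {X : Type*} [MeasurableSpace X]
variable {K : Type*} [NormedAddCommGroup K] [InnerProductSpace ℂ K]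

/-- An operator-valued function is weakly measurable if its matrix entries are measurable. -/
def WeakMeasurable (f : X → (K →L[ℂ] K)) : Prop :=
  ∀ u v : K, Measurable fun x => inner ℂ u (f x v)

theorem measurable_of_hasSum {ι : Type*} [Countable ι] {f : ι → X → ℂ} {g : X → ℂ}
    (hf : ∀ i, Measurable (f i)) (h : ∀ x, HasSum (fun i => f i x) (g x)) : Measurable g := by
  -- Countability of `ι` makes `atTop` on `Finset ι` countably generated, as measurability of a
  -- limit requires.
  refine measurable_of_tendsto_metrizable' (f := fun (F : Finset ι) x => ∑ i ∈ F, f i x)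
    Filter.atTop (fun F => Finset.measurable_fun_sum F fun i _ => hf i) ?_
  rw [tendsto_pi_nhds]
  exact fun x => h x

theorem WeakMeasurable.add {f g : X → (K →L[ℂ] K)} (hf : WeakMeasurable f)
    (hg : WeakMeasurable g) : WeakMeasurable (f + g) := fun u v => by
  simp only [Pi.add_apply, add_apply, inner_add_right]
  exact (hf u v).add (hg u v)

theorem WeakMeasurable.smul {f : X → (K →L[ℂ] K)} (hf : WeakMeasurable f) (c : ℂ) :
    WeakMeasurable (c • f) := fun u v => by
  simpa only [Pi.smul_apply, smul_apply, inner_smul_right] using (hf u v).const_mul c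

theorem weakMeasurable_const (A : K →L[ℂ] K) : WeakMeasurable fun _ : X => A :=
  fun _ _ => measurable_const

theorem inner_apply_polarization (A : K →L[ℂ] K) (u v : K) : inner ℂ u (A v) =
    (inner ℂ (u + v) (A (u + v)) - inner ℂ (u - v) (A (u - v)) -
      Complex.I * inner ℂ (u + Complex.I • v) (A (u + Complex.I • v)) +
      Complex.I * inner ℂ (u - Complex.I • v) (A (u - Complex.I • v))) / 4 := by
  simp only [map_add, map_sub, map_smul, inner_add_left, inner_add_right, inner_sub_left,
    inner_sub_right, inner_smul_left, inner_smul_right, Complex.conj_I]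
  ring_nf
  simp only [Complex.I_sq]
  ring

theorem exists_unit_inner_apply {u : K} (hu : u ≠ 0) : ∃ w : K, ‖w‖ = 1 ∧
    ∀ A : K →L[ℂ] K, inner ℂ u (A u) = ((‖u‖ ^ 2 : ℝ) : ℂ) * inner ℂ w (A w) := by
  have hn : ‖u‖ ≠ 0 := norm_ne_zero_iff.2 hu
  refine ⟨((‖u‖⁻¹ : ℝ) : ℂ) • u, ?_, fun A => ?_⟩
  · rw [norm_smul, Complex.norm_real, norm_inv, norm_norm, inv_mul_cancel₀ hn]
  · rw [map_smul, inner_smul_left, inner_smul_right, Complex.conj_ofReal]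
    push_cast
    have : (‖u‖ : ℂ) ≠ 0 := by exact_mod_cast hn
    field_simp

theorem WeakMeasurable.of_quadratic {f : X → (K →L[ℂ] K)}
    (hf : ∀ u, Measurable fun x => inner ℂ u (f x u)) : WeakMeasurable f := by
  intro u v
  simp only [inner_apply_polarization _ u v]
  have := hf (u + v)
  have := hf (u - v)
  have := hf (u + Complex.I • v)
  have := hf (u - Complex.I • v)
  fun_prop

theorem nonneg_of_dense {A : K →L[ℂ] K} {Q : Set K} (hQ : Dense Q)
    (h : ∀ u ∈ Q, 0 ≤ inner ℂ u (A u)) : 0 ≤ A := by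
  rw [nonneg_iff_inner]
  intro x
  have hc : IsClosed {x : K | 0 ≤ inner ℂ x (A x)} :=
    isClosed_le continuous_const (continuous_id.inner A.continuous)
  exact (hc.closure_subset_iff.2 h) (hQ x)

variable [CompleteSpace K]

theorem IsQRV.weakMeasurable {f : X → (K →L[ℂ] K)} (hf : IsQRV f) : WeakMeasurable f := by
  refine WeakMeasurable.of_quadratic fun u => ?_
  by_cases hu : u = 0
  · simp [hu]
  obtain ⟨w, hw, e⟩ := exists_unit_inner_apply hu
  have h := hf _ (isState_rankOne hw)
  simp only [tr_rankOne_mul hw] at h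
  simp only [e]
  exact h.const_mul _

theorem WeakMeasurable.of_basis {ι : Type*} [Countable ι] (b : HilbertBasis ι ℂ K)
    {f : X → (K →L[ℂ] K)} (hf : ∀ i j, Measurable fun x => inner ℂ (b i) (f x (b j))) :
    WeakMeasurable f := by
  have h : ∀ i v, Measurable fun x => inner ℂ (b i) (f x v) := fun i v => by
    refine measurable_of_hasSum (fun j => (hf i j).mul_const (inner ℂ (b j) v)) fun x => ?_
    have := b.hasSum_inner_mul_inner (ContinuousLinearMap.adjoint (f x) (b i)) v
    simpa only [ContinuousLinearMap.adjoint_inner_left] using this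
  intro u v
  exact measurable_of_hasSum (fun i => (h i v).const_mul (inner ℂ u (b i))) fun x =>
    b.hasSum_inner_mul_inner u (f x v)

theorem weakMeasurable_of_mem_qrvSpan {f : X → (K →L[ℂ] K)} (hf : f ∈ qrvSpan X K) :
    WeakMeasurable f := by
  induction hf using Submodule.span_induction with
  | mem f hf => exact hf.1.weakMeasurable
  | zero => exact weakMeasurable_const 0
  | add f g _ _ hf hg => exact hf.add hg
  | smul c f _ hf => exact hf.smul c

/-- The spectrum of `A` lies in `[0, ‖A‖] ⊆ [0, n]`, so the functional calculus turns the uniform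
estimate there into a norm estimate. -/
theorem norm_aeval_sub_opSqrt_le {A : K →L[ℂ] K} (hA : 0 ≤ A) {n : ℕ} (hn : ‖A‖ ≤ n)
    {p : Polynomial ℝ} {ε : ℝ} (hε : 0 ≤ ε)
    (hp : ∀ t ∈ Set.Icc (0 : ℝ) n, |p.eval t - Real.sqrt t| < ε) :
    ‖Polynomial.aeval A p - opSqrt A‖ ≤ ε := by
  have hsa : IsSelfAdjoint A := IsSelfAdjoint.of_nonneg hA
  have e1 : Polynomial.aeval A p = cfc p.eval A := (cfc_polynomial p A).symm
  have e2 : opSqrt A = cfc Real.sqrt A := by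
    rw [opSqrt, CFC.sqrt_eq_real_sqrt A hA, cfcₙ_eq_cfc]
  rw [e1, e2, ← cfc_sub _ _ A]
  refine norm_cfc_le hε fun t ht => ?_
  refine (hp t ⟨spectrum_nonneg_of_nonneg hA ht, ?_⟩).le
  refine (Real.le_norm_self t).trans ((spectrum.norm_le_norm_mul_of_mem ht).trans ?_)
  have h1 : ‖(1 : K →L[ℂ] K)‖ ≤ 1 := ContinuousLinearMap.norm_id_le
  nlinarith [norm_nonneg A]

variable [TopologicalSpace.SeparableSpace K]

theorem WeakMeasurable.isQRV {f : X → (K →L[ℂ] K)} (hf : WeakMeasurable f) : IsQRV f := by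
  intro s hs
  refine measurable_of_hasSum (fun i => hf (s (onb K i)) (onb K i)) fun x => ?_
  simpa only [inner_comm_of_nonneg hs.1] using hs.hasSum_tr (f x)

theorem WeakMeasurable.mul {f g : X → (K →L[ℂ] K)} (hf : WeakMeasurable f)
    (hg : WeakMeasurable g) : WeakMeasurable fun x => f x * g x := by
  intro u v
  refine measurable_of_hasSum (fun i => (hf u (onb K i)).mul (hg (onb K i) v)) fun x => ?_
  have := (onb K).hasSum_inner_mul_inner (ContinuousLinearMap.adjoint (f x) u) (g x v)
  simp only [ContinuousLinearMap.adjoint_inner_left] at this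
  exact this

theorem mem_qrvSpan_of_nonneg {f : X → (K →L[ℂ] K)} (hf : WeakMeasurable f) (h : ∀ x, 0 ≤ f x) :
    f ∈ qrvSpan X K :=
  Submodule.subset_span ⟨hf.isQRV, h⟩

theorem WeakMeasurable.aeval {f : X → (K →L[ℂ] K)} (hf : WeakMeasurable f) (p : Polynomial ℝ) :
    WeakMeasurable fun x => Polynomial.aeval (f x) p := by
  induction p using Polynomial.induction_on with
  | C a => simpa using weakMeasurable_const _
  | add p q hp hq =>
    simp only [map_add]
    exact hp.add hq
  | monomial n a h =>
    have := h.mul hf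
    simpa [pow_succ, mul_assoc] using this

/-- A countable dense set of finite linear combinations of basis vectors. -/
theorem exists_countable_dense_span_onb (K : Type*) [NormedAddCommGroup K]
    [InnerProductSpace ℂ K] [CompleteSpace K] [TopologicalSpace.SeparableSpace K] :
    ∃ Q : Set K, Q.Countable ∧ Dense Q ∧
      Q ⊆ (Submodule.span ℂ (Set.range (onb K)) : Set K) := by
  have hd : Dense (Submodule.span ℂ (Set.range (onb K)) : Set K) :=
    Submodule.dense_iff_topologicalClosure_eq_top.2 (onb K).dense_span
  obtain ⟨t, hts, htc, htd⟩ := hd.exists_countable_dense_subset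
  exact ⟨t, htc, htd, hts⟩

theorem WeakMeasurable.measurableSet_nonneg {f : X → (K →L[ℂ] K)} (hf : WeakMeasurable f) :
    MeasurableSet {x | 0 ≤ f x} := by
  obtain ⟨Q, hQc, hQd, -⟩ := exists_countable_dense_span_onb K
  have e : {x | 0 ≤ f x} = ⋂ u ∈ Q, {x | 0 ≤ inner ℂ u (f x u)} := by
    ext x
    simp only [Set.mem_ofPred_eq, Set.mem_iInter]
    exact ⟨fun h u _ => nonneg_iff_inner.1 h u, fun h => nonneg_of_dense hQd h⟩
  rw [e]
  refine MeasurableSet.biInter hQc fun u _ => ?_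
  exact hf u u (isClosed_Ici (a := (0 : ℂ))).measurableSet

theorem exists_polynomial_near_sqrt (n : ℕ) : ∃ p : Polynomial ℝ,
    ∀ t ∈ Set.Icc (0 : ℝ) n, |p.eval t - Real.sqrt t| < 1 / ((n : ℝ) + 1) :=
  exists_polynomial_near_of_continuousOn 0 n Real.sqrt Real.continuous_sqrt.continuousOn _
    (by positivity)

/-- The root is a pointwise norm limit of polynomials in `f x`. The `n`-th polynomial is accurate to
`1/(n+1)` on `[0, n]`, an interval growing with `n`, so `f` need not be uniformly bounded. -/
theorem WeakMeasurable.opSqrt {f : X → (K →L[ℂ] K)} (hf : WeakMeasurable f) :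
    WeakMeasurable fun x => opSqrt (f x) := by
  classical
  intro u v
  choose p hp using exists_polynomial_near_sqrt
  refine measurable_of_tendsto_metrizable (f := fun n =>
    Set.indicator {x | 0 ≤ f x} fun x => inner ℂ u (Polynomial.aeval (f x) (p n) v))
    (fun n => (hf.aeval (p n) u v).indicator hf.measurableSet_nonneg) ?_
  rw [tendsto_pi_nhds]
  intro x
  by_cases hx : 0 ≤ f x
  · simp only [Set.indicator_of_mem (s := {x | 0 ≤ f x}) hx]
    have h : Filter.Tendsto (fun n => Polynomial.aeval (f x) (p n)) Filter.atTop
        (nhds (QRV.opSqrt (f x))) := by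
      rw [tendsto_iff_norm_sub_tendsto_zero]
      refine squeeze_zero' (Filter.Eventually.of_forall fun _ => norm_nonneg _) ?_
        tendsto_one_div_add_atTop_nhds_zero_nat
      filter_upwards [Filter.eventually_ge_atTop ⌈‖f x‖⌉₊] with n hn
      exact norm_aeval_sub_opSqrt_le hx (Nat.ceil_le.1 hn) (by positivity) (hp n)
    exact tendsto_const_nhds.inner (((ContinuousLinearMap.apply ℂ K v).continuous.tendsto _).comp h)
  -- Off the positivity set `CFC.sqrt` takes the default value `0`, matching the indicator.
  · simp only [Set.indicator_of_notMem (s := {x | 0 ≤ f x}) hx]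
    rw [QRV.opSqrt, CFC.sqrt_of_not_nonneg hx]
    simp

theorem WeakMeasurable.funTensor {H₁ : Type*} [NormedAddCommGroup H₁] [InnerProductSpace ℂ H₁]
    [CompleteSpace H₁] [TopologicalSpace.SeparableSpace H₁] {H₂ : Type*} [NormedAddCommGroup H₂]
    [InnerProductSpace ℂ H₂] [CompleteSpace H₂] [TopologicalSpace.SeparableSpace H₂]
    {f : X → (H₁ →L[ℂ] H₁)} {g : X → (H₂ →L[ℂ] H₂)} (hf : WeakMeasurable f)
    (hg : WeakMeasurable g) : WeakMeasurable (funTensor f g) := by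
  refine WeakMeasurable.of_basis (tensorBasis (onb H₁) (onb H₂)) fun i j => ?_
  simp only [tensorBasis_apply, QRV.funTensor, opTensor_htmul, inner_htmul]
  exact (hf _ _).mul (hg _ _)

end WeakMeasurability

/-! ### Positivity and uniqueness of the derivative, and the derivative of the tensor POVM. -/

section Derivative

variable {X : Type*} [MeasurableSpace X]
variable {K : Type*} [NormedAddCommGroup K] [InnerProductSpace ℂ K] [CompleteSpace K]

theorem isRNDeriv_rnDeriv {ν : POVM X K} {μ : Measure X} (h : HasRNDeriv ν μ) :
    IsRNDeriv ν μ (rnDeriv ν μ) := by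
  rw [rnDeriv, dif_pos h]
  exact h.choose_spec

theorem ae_nonneg_of_setIntegral_nonneg {μ : Measure X} {F : X → ℂ} (hF : Integrable F μ)
    (h : ∀ E, MeasurableSet E → 0 ≤ ∫ x in E, F x ∂μ) : ∀ᵐ x ∂μ, 0 ≤ F x := by
  have hre : ∀ E, ∫ x in E, (F x).re ∂μ = (∫ x in E, F x ∂μ).re := fun E =>
    integral_re hF.integrableOn
  have him : ∀ E, ∫ x in E, (F x).im ∂μ = (∫ x in E, F x ∂μ).im := fun E =>
    integral_im hF.integrableOn
  have h1 : 0 ≤ᵐ[μ] fun x => (F x).re :=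
    ae_nonneg_of_forall_setIntegral_nonneg hF.re fun E hE _ => by
      rw [hre]; exact (Complex.nonneg_iff.1 (h E hE)).1
  have h2 : (fun x => (F x).im) =ᵐ[μ] 0 :=
    Integrable.ae_eq_zero_of_forall_setIntegral_eq_zero hF.im fun E hE _ => by
      rw [him]; exact (Complex.nonneg_iff.1 (h E hE)).2.symm
  filter_upwards [h1, h2] with x hx1 hx2
  exact Complex.nonneg_iff.2 ⟨hx1, hx2.symm⟩

theorem integral_polarization {m : Measure X} {a b c d : X → ℂ} (ha : Integrable a m)
    (hb : Integrable b m) (hc : Integrable c m) (hd : Integrable d m) :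
    (∫ x, a x ∂m - ∫ x, b x ∂m - Complex.I * ∫ x, c x ∂m + Complex.I * ∫ x, d x ∂m) / 4 =
      ∫ x, (a x - b x - Complex.I * c x + Complex.I * d x) / 4 ∂m := by
  have h1 : Integrable (fun x => a x - b x) m := ha.sub hb
  have h2 : Integrable (fun x => a x - b x - Complex.I * c x) m := h1.sub (hc.const_mul _)
  rw [integral_div, integral_add h2 (hd.const_mul _), integral_sub h1 (hc.const_mul _),
    integral_sub ha hb, integral_const_mul, integral_const_mul]

/-- The entries of the derivative in finite linear combinations of basis vectors. -/
theorem IsRNDeriv.entry {ν : POVM X K} {μ : Measure X} {D : X → (K →L[ℂ] K)}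
    (hD : IsRNDeriv ν μ D) {u v : K} (hu : u ∈ Submodule.span ℂ (Set.range (onb K)))
    (hv : v ∈ Submodule.span ℂ (Set.range (onb K))) :
    Integrable (fun x => inner ℂ u (D x v)) μ ∧ ∀ E, MeasurableSet E →
      inner ℂ u (ν.toFun E v) = ∫ x in E, inner ℂ u (D x v) ∂μ := by
  induction hu using Submodule.span_induction with
  | mem u hu =>
    obtain ⟨i, rfl⟩ := hu
    induction hv using Submodule.span_induction with
    | mem v hv =>
      obtain ⟨j, rfl⟩ := hv
      exact hD.2 i j
    | zero => simp
    | add v w _ _ hv hw =>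
      simp only [map_add, inner_add_right]
      refine ⟨hv.1.add hw.1, fun E hE => ?_⟩
      rw [hv.2 E hE, hw.2 E hE, integral_add hv.1.integrableOn hw.1.integrableOn]
    | smul c v _ hv =>
      simp only [map_smul, inner_smul_right]
      refine ⟨hv.1.const_mul c, fun E hE => ?_⟩
      rw [hv.2 E hE, integral_const_mul]
  | zero => simp
  | add u w _ _ hu hw =>
    simp only [inner_add_left]
    refine ⟨hu.1.add hw.1, fun E hE => ?_⟩
    rw [hu.2 E hE, hw.2 E hE, integral_add hu.1.integrableOn hw.1.integrableOn]
  | smul c u _ hu =>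
    simp only [inner_smul_left]
    refine ⟨hu.1.const_mul _, fun E hE => ?_⟩
    rw [hu.2 E hE, integral_const_mul]

variable [TopologicalSpace.SeparableSpace K]

/-- The exceptional null set depends on the test vector, so only countably many are used; they lie
in the algebraic span of the basis, where the densities are known. -/
theorem IsRNDeriv.ae_nonneg {ν : POVM X K} {μ : Measure X} {D : X → (K →L[ℂ] K)}
    (hD : IsRNDeriv ν μ D) : ∀ᵐ x ∂μ, 0 ≤ D x := by
  obtain ⟨Q, hQc, hQd, hQs⟩ := exists_countable_dense_span_onb K
  have h : ∀ᵐ x ∂μ, ∀ u ∈ Q, 0 ≤ inner ℂ u (D x u) := by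
    rw [ae_ball_iff hQc]
    intro u hu
    obtain ⟨h1, h2⟩ := hD.entry (hQs hu) (hQs hu)
    refine ae_nonneg_of_setIntegral_nonneg h1 fun E hE => ?_
    rw [← h2 E hE]
    exact nonneg_iff_inner.1 (ν.nonneg E hE) u
  filter_upwards [h] with x hx using nonneg_of_dense hQd hx

/-- `rnDeriv` is an arbitrary choice of version; this uniqueness, from countably many matrix
entries, identifies it with `D ⊗ D` for the tensor POVM. -/
theorem IsRNDeriv.ae_eq {ν : POVM X K} {μ : Measure X} {D D' : X → (K →L[ℂ] K)}
    (hD : IsRNDeriv ν μ D) (hD' : IsRNDeriv ν μ D') : D =ᵐ[μ] D' := by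
  have h : ∀ᵐ x ∂μ, ∀ i j, inner ℂ (onb K i) (D x (onb K j)) =
      inner ℂ (onb K i) (D' x (onb K j)) := by
    rw [ae_all_iff]
    intro i
    rw [ae_all_iff]
    intro j
    exact Integrable.ae_eq_of_forall_setIntegral_eq _ _ (hD.2 i j).1 (hD'.2 i j).1
      fun E hE _ => by rw [← (hD.2 i j).2 E hE, ← (hD'.2 i j).2 E hE]
  filter_upwards [h] with x hx
  refine ContinuousLinearMap.ext_on
    (Submodule.dense_iff_topologicalClosure_eq_top.2 (onb K).dense_span) ?_
  rintro _ ⟨j, rfl⟩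
  refine (onb K).repr.injective ?_
  ext i
  simpa only [HilbertBasis.repr_apply_apply] using hx i j

variable {H₁ : Type*} [NormedAddCommGroup H₁] [InnerProductSpace ℂ H₁] [CompleteSpace H₁]
variable {H₂ : Type*} [NormedAddCommGroup H₂] [InnerProductSpace ℂ H₂] [CompleteSpace H₂]

/-- Vector states give the quadratic forms, and polarization gives the remaining entries. -/
theorem IsTensorPOVM.entry {μ : Measure X} {ν₁ : POVM X H₁} {ν₂ : POVM X H₂}
    {ν : POVM X (HTensor H₁ H₂)} (h : IsTensorPOVM μ ν₁ ν₂ ν) (u v : HTensor H₁ H₂) :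
    Integrable (fun x => inner ℂ u (funTensor (rnDeriv ν₁ μ) (rnDeriv ν₂ μ) x v)) μ ∧
      ∀ E, MeasurableSet E → inner ℂ u (ν.toFun E v) =
        ∫ x in E, inner ℂ u (funTensor (rnDeriv ν₁ μ) (rnDeriv ν₂ μ) x v) ∂μ := by
  have hq : ∀ u : HTensor H₁ H₂,
      Integrable (fun x => inner ℂ u (funTensor (rnDeriv ν₁ μ) (rnDeriv ν₂ μ) x u)) μ ∧
      ∀ E, MeasurableSet E → inner ℂ u (ν.toFun E u) =
        ∫ x in E, inner ℂ u (funTensor (rnDeriv ν₁ μ) (rnDeriv ν₂ μ) x u) ∂μ := by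
    intro u
    by_cases hu : u = 0
    · simp [hu]
    obtain ⟨w, hw, e⟩ := exists_unit_inner_apply hu
    obtain ⟨h1, h2⟩ := h _ (isState_rankOne hw)
    simp only [tr_rankOne_mul hw] at h1 h2
    simp only [e]
    refine ⟨h1.const_mul _, fun E hE => ?_⟩
    rw [h2 E hE, integral_const_mul]
    rfl
  simp only [inner_apply_polarization _ u v]
  obtain ⟨a1, a2⟩ := hq (u + v)
  obtain ⟨b1, b2⟩ := hq (u - v)
  obtain ⟨c1, c2⟩ := hq (u + Complex.I • v)
  obtain ⟨d1, d2⟩ := hq (u - Complex.I • v)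
  refine ⟨(((a1.sub b1).sub (c1.const_mul _)).add (d1.const_mul _)).div_const 4, fun E hE => ?_⟩
  rw [a2 E hE, b2 E hE, c2 E hE, d2 E hE]
  exact integral_polarization a1.integrableOn b1.integrableOn c1.integrableOn d1.integrableOn

variable [TopologicalSpace.SeparableSpace H₁] [TopologicalSpace.SeparableSpace H₂]

theorem IsTensorPOVM.isRNDeriv {μ : Measure X} {ν₁ : POVM X H₁} {ν₂ : POVM X H₂}
    {ν : POVM X (HTensor H₁ H₂)} (h : IsTensorPOVM μ ν₁ ν₂ ν) (h₁ : HasRNDeriv ν₁ μ)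
    (h₂ : HasRNDeriv ν₂ μ) :
    IsRNDeriv ν μ (funTensor (rnDeriv ν₁ μ) (rnDeriv ν₂ μ)) :=
  ⟨((isRNDeriv_rnDeriv h₁).1.weakMeasurable.funTensor
    (isRNDeriv_rnDeriv h₂).1.weakMeasurable).isQRV, fun _ _ => h.entry _ _⟩

theorem IsTensorPOVM.rnDeriv_ae_eq {μ : Measure X} {ν₁ : POVM X H₁} {ν₂ : POVM X H₂}
    {ν : POVM X (HTensor H₁ H₂)} (h : IsTensorPOVM μ ν₁ ν₂ ν) (h₁ : HasRNDeriv ν₁ μ)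
    (h₂ : HasRNDeriv ν₂ μ) :
    rnDeriv ν μ =ᵐ[μ] funTensor (rnDeriv ν₁ μ) (rnDeriv ν₂ μ) :=
  (isRNDeriv_rnDeriv ⟨_, h.isRNDeriv h₁ h₂⟩).ae_eq (h.isRNDeriv h₁ h₂)

end Derivative

/-! ### Conjugation by positive operators, and reduction from convex hulls to product states. -/

section Preliminaries

theorem conj_nonneg {K : Type*} [NormedAddCommGroup K] [InnerProductSpace ℂ K]
    {R A : K →L[ℂ] K} (hR : 0 ≤ R) (hA : 0 ≤ A) : 0 ≤ R * A * R := by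
  rw [nonneg_iff_inner]
  intro x
  rw [mul_apply_eq_comp, mul_apply_eq_comp, ← inner_comm_of_nonneg hR]
  exact nonneg_iff_inner.1 hA _

theorem exists_seq_of_mem_closure {K : Type*} [NormedAddCommGroup K] [InnerProductSpace ℂ K]
    {C : Set (K →L[ℂ] K)} {s : K →L[ℂ] K} (hs : s ∈ closure C) :
    ∃ t : ℕ → K →L[ℂ] K, (∀ n, t n ∈ C) ∧ Filter.Tendsto t Filter.atTop (nhds s) :=
  mem_closure_iff_seq_limit.1 hs

theorem convexHull_productStates_subset {H₁ : Type*} [NormedAddCommGroup H₁]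
    [InnerProductSpace ℂ H₁] [CompleteSpace H₁] {H₂ : Type*} [NormedAddCommGroup H₂]
    [InnerProductSpace ℂ H₂] [CompleteSpace H₂] {C : Set (HTensor H₁ H₂ →L[ℂ] HTensor H₁ H₂)}
    (hC : Convex ℝ C) (h : ∀ s₁ s₂, IsState s₁ → IsState s₂ → opTensor s₁ s₂ ∈ C) :
    convexHull ℝ {t | ∃ (s₁ : H₁ →L[ℂ] H₁) (s₂ : H₂ →L[ℂ] H₂),
      IsState s₁ ∧ IsState s₂ ∧ t = opTensor s₁ s₂} ⊆ C := by
  refine convexHull_min ?_ hC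
  rintro _ ⟨s₁, s₂, h₁, h₂, rfl⟩
  exact h s₁ s₂ h₁ h₂

end Preliminaries

/-! ### The scalar functions attached to a state, and their comparison with the norm. -/

section StateFun

variable {X : Type*} [MeasurableSpace X]
variable {K : Type*} [NormedAddCommGroup K] [InnerProductSpace ℂ K] [CompleteSpace K]
variable {ν : POVM X K} {μ : Measure X} {s : K →L[ℂ] K}

theorem stateFun_eq (ν : POVM X K) (μ : Measure X) (s : K →L[ℂ] K) (f : X → (K →L[ℂ] K)) (x : X) :
    stateFun ν μ s f x = tr (s * (opSqrt (rnDeriv ν μ x) * f x * opSqrt (rnDeriv ν μ x))) :=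
  rfl

theorem stateFun_nonneg (hs : IsState s) {f : X → (K →L[ℂ] K)} {x : X} (hf : 0 ≤ f x) :
    0 ≤ stateFun ν μ s f x :=
  hs.tr_nonneg (conj_nonneg (opSqrt_nonneg _) hf)

theorem stateFun_add (hs : IsState s) (f g : X → (K →L[ℂ] K)) (x : X) :
    stateFun ν μ s (f + g) x = stateFun ν μ s f x + stateFun ν μ s g x := by
  simp only [stateFun_eq, Pi.add_apply, mul_add, add_mul, ← hs.tr_add]

theorem stateFun_smul (hs : IsState s) (c : ℂ) (f : X → (K →L[ℂ] K)) (x : X) :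
    stateFun ν μ s (c • f) x = c * stateFun ν μ s f x := by
  simp only [stateFun_eq, Pi.smul_apply, ← hs.tr_smul, mul_smul_comm, smul_mul_assoc]

theorem stateFun_sub (hs : IsState s) (f g : X → (K →L[ℂ] K)) (x : X) :
    stateFun ν μ s (f - g) x = stateFun ν μ s f x - stateFun ν μ s g x := by
  have h : f - g = f + (-1 : ℂ) • g := by rw [neg_one_smul, sub_eq_add_neg]
  rw [h, stateFun_add hs, stateFun_smul hs]
  ring

theorem norm_stateFun_le_of_mem_posDecomp (hs : IsState s) {f : X → (K →L[ℂ] K)}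
    {F : Fin 4 → X → (K →L[ℂ] K)} (hF : F ∈ posDecomp f) (x : X) :
    ‖stateFun ν μ s f x‖ ≤ ‖stateFun ν μ s (F 0 + F 1 + F 2 + F 3) x‖ := by
  obtain ⟨-, h0, hf⟩ := hF
  -- For nonnegative numbers the modulus of the sum is the sum of the moduli, so the triangle
  -- inequality suffices.
  have key : ∀ a b c d : ℂ, 0 ≤ a → 0 ≤ b → 0 ≤ c → 0 ≤ d →
      ‖a - b + Complex.I * c - Complex.I * d‖ ≤ ‖a + b + c + d‖ := by
    intro a b c d ha hb hc hd
    have e : ‖a + b + c + d‖ = ‖a‖ + ‖b‖ + ‖c‖ + ‖d‖ := by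
      have hn : ∀ z : ℂ, 0 ≤ z → ((‖z‖ : ℝ) : ℂ) = z := fun z hz => by
        exact Complex.norm_of_nonneg' hz
      rw [← Complex.ofReal_inj]
      push_cast
      rw [hn _ (by positivity), hn a ha, hn b hb, hn c hc, hn d hd]
    rw [e]
    calc ‖a - b + Complex.I * c - Complex.I * d‖
        ≤ ‖a‖ + ‖b‖ + ‖Complex.I * c‖ + ‖Complex.I * d‖ :=
          (norm_sub_le _ _).trans (by
            gcongr
            exact (norm_add_le _ _).trans (by gcongr; exact norm_sub_le _ _))
      _ = ‖a‖ + ‖b‖ + ‖c‖ + ‖d‖ := by simp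
  rw [hf, stateFun_sub hs, stateFun_add hs, stateFun_sub hs, stateFun_smul hs, stateFun_smul hs,
    stateFun_add hs, stateFun_add hs, stateFun_add hs]
  exact key _ _ _ _ (stateFun_nonneg hs (h0 0 x)) (stateFun_nonneg hs (h0 1 x))
    (stateFun_nonneg hs (h0 2 x)) (stateFun_nonneg hs (h0 3 x))

theorem eLpNorm_stateFun_le_pNorm (hs : IsState s) (p : ℝ) (f : X → (K →L[ℂ] K)) :
    eLpNorm (stateFun ν μ s f) (ENNReal.ofReal p) μ ≤ pNorm ν μ p f :=
  le_iInf₂ fun F hF => (eLpNorm_mono fun x => norm_stateFun_le_of_mem_posDecomp hs hF x).trans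
    (le_iSup₂ (f := fun (s : K →L[ℂ] K) (_ : IsState s) =>
      eLpNorm (stateFun ν μ s (F 0 + F 1 + F 2 + F 3)) (ENNReal.ofReal p) μ) s hs)

/-- For a positive function the trivial decomposition bounds the norm. -/
theorem pNorm_le_of_nonneg {f : X → (K →L[ℂ] K)} (hf : f ∈ qrvSpan X K) (h0 : ∀ x, 0 ≤ f x)
    {p : ℝ} {c : ℝ≥0∞}
    (hc : ∀ s, IsState s → eLpNorm (stateFun ν μ s f) (ENNReal.ofReal p) μ ≤ c) :
    pNorm ν μ p f ≤ c := by
  refine iInf₂_le_of_le ![f, 0, 0, 0] ⟨?_, ?_, by simp⟩ (iSup₂_le fun s hs => ?_)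
  · intro k
    fin_cases k
    · exact hf
    all_goals exact Submodule.zero_mem _
  · intro k x
    fin_cases k
    · exact h0 x
    all_goals exact le_rfl
  · simpa using hc s hs

theorem measurable_stateFun [TopologicalSpace.SeparableSpace K] (h : HasRNDeriv ν μ)
    (hs : IsState s) {f : X → (K →L[ℂ] K)} (hf : WeakMeasurable f) :
    Measurable (stateFun ν μ s f) := by
  have hD : WeakMeasurable fun x => opSqrt (rnDeriv ν μ x) :=
    (isRNDeriv_rnDeriv h).1.weakMeasurable.opSqrt
  exact ((hD.mul hf).mul hD).isQRV s hs

end StateFun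

/-! ### Hölder's inequality on separable states. -/

section Separable

variable {X : Type*} [MeasurableSpace X]
variable {H₁ : Type*} [NormedAddCommGroup H₁] [InnerProductSpace ℂ H₁] [CompleteSpace H₁]
variable {H₂ : Type*} [NormedAddCommGroup H₂] [InnerProductSpace ℂ H₂] [CompleteSpace H₂]
variable [TopologicalSpace.SeparableSpace H₁] [TopologicalSpace.SeparableSpace H₂]
variable {μ : Measure X} {ν₁ : POVM X H₁} {ν₂ : POVM X H₂} {ν : POVM X (HTensor H₁ H₂)}

/-- Where `D₁, D₂ ≥ 0` the root of `D₁ ⊗ D₂` splits, and the conjugation is then carried out factor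
by factor. -/
theorem IsTensorPOVM.stateFun_ae_eq (h : IsTensorPOVM μ ν₁ ν₂ ν) (h₁ : HasRNDeriv ν₁ μ)
    (h₂ : HasRNDeriv ν₂ μ) (f : X → (H₁ →L[ℂ] H₁)) (g : X → (H₂ →L[ℂ] H₂)) :
    ∀ᵐ x ∂μ, ∀ s, stateFun ν μ s (funTensor f g) x =
      tr (s * opTensor (opSqrt (rnDeriv ν₁ μ x) * f x * opSqrt (rnDeriv ν₁ μ x))
        (opSqrt (rnDeriv ν₂ μ x) * g x * opSqrt (rnDeriv ν₂ μ x))) := by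
  filter_upwards [h.rnDeriv_ae_eq h₁ h₂, (isRNDeriv_rnDeriv h₁).ae_nonneg,
    (isRNDeriv_rnDeriv h₂).ae_nonneg] with x hx hx₁ hx₂ s
  rw [stateFun_eq, hx, funTensor, funTensor, opSqrt_opTensor hx₁ hx₂, opTensor_mul, opTensor_mul]

theorem IsTensorPOVM.stateFun_product_ae_eq (h : IsTensorPOVM μ ν₁ ν₂ ν) (h₁ : HasRNDeriv ν₁ μ)
    (h₂ : HasRNDeriv ν₂ μ) (f : X → (H₁ →L[ℂ] H₁)) (g : X → (H₂ →L[ℂ] H₂))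
    {s₁ : H₁ →L[ℂ] H₁} {s₂ : H₂ →L[ℂ] H₂} (hs₁ : IsState s₁) (hs₂ : IsState s₂) :
    stateFun ν μ (opTensor s₁ s₂) (funTensor f g) =ᵐ[μ]
      fun x => stateFun ν₁ μ s₁ f x * stateFun ν₂ μ s₂ g x := by
  filter_upwards [h.stateFun_ae_eq h₁ h₂ f g] with x hx
  rw [hx, tr_opTensor_mul hs₁ hs₂]
  rfl

theorem eLpNorm_mul_le_of_holderConjugate {p q : ℝ} (hpq : p.HolderConjugate q) {a b : X → ℂ}
    (ha : Measurable a) (hb : Measurable b) :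
    eLpNorm (fun x => a x * b x) (ENNReal.ofReal 1) μ ≤
      eLpNorm a (ENNReal.ofReal p) μ * eLpNorm b (ENNReal.ofReal q) μ := by
  have := hpq.ennrealOfReal
  rw [ENNReal.ofReal_one]
  simpa using eLpNorm_le_eLpNorm_mul_eLpNorm_of_nnnorm (r := 1) ha.aestronglyMeasurable
    hb.aestronglyMeasurable (fun z w : ℂ => z * w) 1
    (Filter.Eventually.of_forall fun x => by simp)

/-- `F_s` is affine in `s`, so Minkowski's inequality applies. Being a state is part of the set
because the additivity of `tr` used here is established for states. -/
theorem convex_eLpNorm_stateFun_le {K : Type*} [NormedAddCommGroup K] [InnerProductSpace ℂ K]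
    [CompleteSpace K] [TopologicalSpace.SeparableSpace K] {ν : POVM X K} (hν : HasRNDeriv ν μ)
    {F : X → (K →L[ℂ] K)} (hF : WeakMeasurable F) (c : ℝ≥0∞) :
    Convex ℝ {s | IsState s ∧ eLpNorm (stateFun ν μ s F) (ENNReal.ofReal 1) μ ≤ c} := by
  rintro s ⟨hs, hsc⟩ t ⟨ht, htc⟩ a b ha hb hab
  refine ⟨convex_isState hs ht ha hb hab, ?_⟩
  have e : stateFun ν μ (a • s + b • t) F =
      (a : ℂ) • stateFun ν μ s F + (b : ℂ) • stateFun ν μ t F := by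
    funext x
    exact tr_convex_comb hs ht ha hb hab _
  rw [e]
  refine (eLpNorm_add_le ((measurable_stateFun hν hs hF).const_smul _).aestronglyMeasurable
    ((measurable_stateFun hν ht hF).const_smul _).aestronglyMeasurable (by simp)).trans ?_
  rw [eLpNorm_const_smul, eLpNorm_const_smul]
  have en : ∀ r : ℝ, 0 ≤ r → ‖(r : ℂ)‖ₑ = ENNReal.ofReal r := fun r hr => by
    rw [← ofReal_norm, Complex.norm_real, Real.norm_of_nonneg hr]
  calc _ ≤ ‖(a : ℂ)‖ₑ * c + ‖(b : ℂ)‖ₑ * c := by gcongr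
    _ = c := by
      rw [← add_mul, en a ha, en b hb, ← ENNReal.ofReal_add ha hb, hab, ENNReal.ofReal_one, one_mul]

/-- Fatou's lemma along a norm-convergent sequence of states. -/
theorem eLpNorm_stateFun_le_of_tendsto {K : Type*} [NormedAddCommGroup K] [InnerProductSpace ℂ K]
    [CompleteSpace K] [TopologicalSpace.SeparableSpace K] {ν : POVM X K} (hν : HasRNDeriv ν μ)
    {F : X → (K →L[ℂ] K)} (hF : WeakMeasurable F) {p c : ℝ≥0∞} {t : ℕ → K →L[ℂ] K}
    {s : K →L[ℂ] K} (hs : IsState s) (ht : ∀ n, IsState (t n))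
    (hts : Filter.Tendsto t Filter.atTop (nhds s))
    (hc : ∀ n, eLpNorm (stateFun ν μ (t n) F) p μ ≤ c) :
    eLpNorm (stateFun ν μ s F) p μ ≤ c := by
  refine (Lp.eLpNorm_lim_le_liminf_eLpNorm
    (fun n => (measurable_stateFun hν (ht n) hF).aestronglyMeasurable) _
    (Filter.Eventually.of_forall fun x => tendsto_tr_of_tendsto ht hs hts _)).trans ?_
  exact (Filter.liminf_le_liminf (Filter.Eventually.of_forall hc)).trans
    (Filter.liminf_const c).le

/-- Hölder's inequality for the separable norm. -/
theorem IsTensorPOVM.sepNorm_funTensor_le (h : IsTensorPOVM μ ν₁ ν₂ ν) (h₁ : HasRNDeriv ν₁ μ)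
    (h₂ : HasRNDeriv ν₂ μ) {p q : ℝ} (hpq : p.HolderConjugate q) {f : X → (H₁ →L[ℂ] H₁)}
    {g : X → (H₂ →L[ℂ] H₂)} (hf : WeakMeasurable f) (hg : WeakMeasurable g) :
    sepNorm ν μ 1 (funTensor f g) ≤ pNorm ν₁ μ p f * pNorm ν₂ μ q g := by
  refine iSup₂_le fun s hs => ?_
  obtain ⟨hs, hcl⟩ := hs
  obtain ⟨t, ht, hts⟩ := exists_seq_of_mem_closure hcl
  have hν : HasRNDeriv ν μ := ⟨_, h.isRNDeriv h₁ h₂⟩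
  have hfg := hf.funTensor hg
  have hmem := fun n => convexHull_productStates_subset (convex_eLpNorm_stateFun_le hν hfg
    (pNorm ν₁ μ p f * pNorm ν₂ μ q g)) (fun s₁ s₂ hs₁ hs₂ => ⟨hs₁.opTensor hs₂, by
      rw [eLpNorm_congr_ae (h.stateFun_product_ae_eq h₁ h₂ f g hs₁ hs₂)]
      exact (eLpNorm_mul_le_of_holderConjugate hpq (measurable_stateFun h₁ hs₁ hf)
        (measurable_stateFun h₂ hs₂ hg)).trans (mul_le_mul'
          (eLpNorm_stateFun_le_pNorm hs₁ p f) (eLpNorm_stateFun_le_pNorm hs₂ q g))⟩) (ht n)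
  exact eLpNorm_stateFun_le_of_tendsto hν hfg hs (fun n => (hmem n).1) hts fun n => (hmem n).2

end Separable

/-! ### Positive operator matrices and Schur's product theorem. -/

section BlockPos

theorem blockPos_of_coe {H₁ : Type*} [NormedAddCommGroup H₁] [InnerProductSpace ℂ H₁]
    {H₂ : Type*} [NormedAddCommGroup H₂] [InnerProductSpace ℂ H₂]
    {S T R : HTensor H₁ H₂ →L[ℂ] HTensor H₁ H₂}
    (h : ∀ u v : H₁ ⊗[ℂ] H₂, 0 ≤ inner ℂ (u : HTensor H₁ H₂) (S u + T v) +
      inner ℂ (v : HTensor H₁ H₂) (ContinuousLinearMap.adjoint T u + R v)) :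
    BlockPos S T R := by
  intro u v
  induction u, v using UniformSpace.Completion.induction_on₂ with
  | hp => exact isClosed_le (by fun_prop) (by fun_prop)
  | ih u v => exact h u v

variable {K : Type*} [NormedAddCommGroup K] [InnerProductSpace ℂ K] [CompleteSpace K]
variable {H₁ : Type*} [NormedAddCommGroup H₁] [InnerProductSpace ℂ H₁] [CompleteSpace H₁]
variable {H₂ : Type*} [NormedAddCommGroup H₂] [InnerProductSpace ℂ H₂] [CompleteSpace H₂]

theorem BlockPos.nonneg_left {S T R : K →L[ℂ] K} (h : BlockPos S T R) : 0 ≤ S :=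
  nonneg_iff_inner.2 fun u => by simpa using h u 0

theorem BlockPos.nonneg_right {S T R : K →L[ℂ] K} (h : BlockPos S T R) : 0 ≤ R :=
  nonneg_iff_inner.2 fun v => by simpa using h 0 v

/-- The Gram matrix of two finite families with respect to an operator block matrix. -/
def blockGram {n m : ℕ} (S T R : K →L[ℂ] K) (a : Fin n → K) (c : Fin m → K) :
    Matrix (Fin n ⊕ Fin m) (Fin n ⊕ Fin m) ℂ :=
  Matrix.fromBlocks (Matrix.of fun i j => inner ℂ (a i) (S (a j)))
    (Matrix.of fun i j => inner ℂ (a i) (T (c j)))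
    (Matrix.of fun i j => inner ℂ (T (c i)) (a j))
    (Matrix.of fun i j => inner ℂ (c i) (R (c j)))

/-- The quadratic form of this matrix at `x` is the block form evaluated at the linear combinations
of `a` and `c` with coefficients `x`. -/
theorem BlockPos.posSemidef_blockGram {S T R : K →L[ℂ] K} (h : BlockPos S T R) {n m : ℕ}
    (a : Fin n → K) (c : Fin m → K) : (blockGram S T R a c).PosSemidef := by
  rw [Matrix.posSemidef_iff_dotProduct_mulVec]
  constructor
  · refine Matrix.IsHermitian.fromBlocks ?_ ?_ ?_
    · ext i j
      simp [inner_comm_of_nonneg h.nonneg_left]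
    · ext i j
      simp
    · ext i j
      simp [inner_comm_of_nonneg h.nonneg_right]
  · intro x
    have hx := h (∑ i, x (Sum.inl i) • a i) (∑ j, x (Sum.inr j) • c j)
    convert hx using 1
    simp only [dotProduct, Matrix.mulVec, Fintype.sum_sum_type, blockGram,
      Matrix.fromBlocks_apply₁₁, Matrix.fromBlocks_apply₁₂, Matrix.fromBlocks_apply₂₁,
      Matrix.fromBlocks_apply₂₂, Matrix.of_apply, inner_add_right,
      ContinuousLinearMap.adjoint_inner_right, map_sum, map_smul, sum_inner, inner_sum,
      inner_smul_left, inner_smul_right, Pi.star_apply, Finset.mul_sum, mul_add,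
      Finset.sum_add_distrib]
    rw [add_add_add_comm]
    congr 1 <;> congr 1 <;> rw [Finset.sum_comm] <;>
      exact Finset.sum_congr rfl fun i _ => Finset.sum_congr rfl fun j _ => by
        simp only [RCLike.star_def]; ring

/-- Positivity of block operator matrices passes to tensor products, by Schur's theorem. -/
theorem BlockPos.opTensor {S₁ T₁ R₁ : H₁ →L[ℂ] H₁} {S₂ T₂ R₂ : H₂ →L[ℂ] H₂}
    (h₁ : BlockPos S₁ T₁ R₁) (h₂ : BlockPos S₂ T₂ R₂) :
    BlockPos (opTensor S₁ S₂) (opTensor T₁ T₂) (opTensor R₁ R₂) := by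
  refine blockPos_of_coe fun u v => ?_
  obtain ⟨n, a, b, hu⟩ := exists_coe_eq_sum_htmul u
  obtain ⟨m, c, d, hv⟩ := exists_coe_eq_sum_htmul v
  rw [hu, hv]
  -- Inner products of elementary tensors multiply, so the Gram matrix of the tensors is a Hadamard
  -- product; pairing it with the all-ones vector sums all its entries.
  have h := ((h₁.posSemidef_blockGram a c).hadamard
    (h₂.posSemidef_blockGram b d)).dotProduct_mulVec_nonneg (fun _ => 1)
  convert h using 1
  simp only [dotProduct, Matrix.mulVec, Fintype.sum_sum_type, blockGram, Matrix.hadamard_apply,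
    Matrix.fromBlocks_apply₁₁, Matrix.fromBlocks_apply₁₂, Matrix.fromBlocks_apply₂₁,
    Matrix.fromBlocks_apply₂₂, Matrix.of_apply, inner_add_right,
    ContinuousLinearMap.adjoint_inner_right, map_sum, sum_inner, inner_sum, opTensor_htmul,
    inner_htmul, Pi.star_apply, star_one, one_mul, mul_one, Finset.sum_add_distrib]
  rw [add_add_add_comm]
  congr 1 <;> congr 1 <;> exact Finset.sum_comm

end BlockPos

/-! ### The decomposable norms. -/

section Dec

variable {X : Type*} [MeasurableSpace X]
variable {K : Type*} [NormedAddCommGroup K] [InnerProductSpace ℂ K] [CompleteSpace K]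
variable {ν : POVM X K} {μ : Measure X}

/-- The block matrix is the sum of `[[F₀, F₀], [F₀, F₀]]`, `[[F₁, -F₁], [-F₁, F₁]]`, `[[F₂, iF₂],
[-iF₂, F₂]]` and `[[F₃, -iF₃], [iF₃, F₃]]`, each of them positive. -/
theorem blockPos_of_mem_posDecomp {f : X → (K →L[ℂ] K)} {F : Fin 4 → X → (K →L[ℂ] K)}
    (hF : F ∈ posDecomp f) (x : X) :
    BlockPos ((F 0 + F 1 + F 2 + F 3) x) (f x) ((F 0 + F 1 + F 2 + F 3) x) := by
  obtain ⟨-, h0, hf⟩ := hF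
  intro u v
  have e := fun k => inner_comm_of_nonneg (h0 k x)
  have key : inner ℂ u ((F 0 + F 1 + F 2 + F 3) x u + f x v) +
      inner ℂ v (ContinuousLinearMap.adjoint (f x) u + (F 0 + F 1 + F 2 + F 3) x v) =
      inner ℂ (u + v) (F 0 x (u + v)) + inner ℂ (u - v) (F 1 x (u - v)) +
      inner ℂ (u + Complex.I • v) (F 2 x (u + Complex.I • v)) +
      inner ℂ (u - Complex.I • v) (F 3 x (u - Complex.I • v)) := by
    rw [hf]
    simp only [inner_add_right, ContinuousLinearMap.adjoint_inner_right, Pi.add_apply,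
      Pi.sub_apply, Pi.smul_apply, add_apply, sub_apply, smul_apply, inner_add_left,
      inner_sub_left, inner_sub_right, inner_smul_left, inner_smul_right, map_add, map_sub,
      map_smul, Complex.conj_I, e]
    ring_nf
    simp only [Complex.I_sq]
    ring
  rw [key]
  have hk := fun k => nonneg_iff_inner.1 (h0 k x)
  exact add_nonneg (add_nonneg (add_nonneg (hk 0 _) (hk 1 _)) (hk 2 _)) (hk 3 _)

/-- The sum of the four parts of a decomposition serves as both majorants. The bound is needed for
the finiteness of `decNorm`. -/
theorem decNorm_le_pNorm (p : ℝ) (f : X → (K →L[ℂ] K)) : decNorm ν μ p f ≤ pNorm ν μ p f := by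
  refine le_iInf₂ fun F hF => ?_
  have hmem : F 0 + F 1 + F 2 + F 3 ∈ qrvSpan X K :=
    add_mem (add_mem (add_mem (hF.1 0) (hF.1 1)) (hF.1 2)) (hF.1 3)
  have h0 : ∀ x, 0 ≤ (F 0 + F 1 + F 2 + F 3) x := fun x =>
    (blockPos_of_mem_posDecomp hF x).nonneg_left
  refine iInf_le_of_le (F 0 + F 1 + F 2 + F 3) (iInf₂_le_of_le (F 0 + F 1 + F 2 + F 3)
    ⟨hmem, hmem, h0, h0, Filter.Eventually.of_forall fun x => blockPos_of_mem_posDecomp hF x⟩ ?_)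
  rw [max_self]
  exact pNorm_le_of_nonneg hmem h0 fun s hs =>
    le_iSup₂ (f := fun (s : K →L[ℂ] K) (_ : IsState s) =>
      eLpNorm (stateFun ν μ s (F 0 + F 1 + F 2 + F 3)) (ENNReal.ofReal p) μ) s hs

theorem exists_of_decNorm_lt {p : ℝ} {f : X → (K →L[ℂ] K)} {a : ℝ≥0∞}
    (h : decNorm ν μ p f < a) : ∃ S R : X → (K →L[ℂ] K), S ∈ qrvSpan X K ∧ R ∈ qrvSpan X K ∧
      (∀ x, 0 ≤ S x) ∧ (∀ x, 0 ≤ R x) ∧ (∀ᵐ x ∂μ, BlockPos (S x) (f x) (R x)) ∧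
      pNorm ν μ p S < a ∧ pNorm ν μ p R < a := by
  simp only [decNorm, iInf_lt_iff, max_lt_iff] at h
  obtain ⟨S, R, ⟨h1, h2, h3, h4, h5⟩, h6, h7⟩ := h
  exact ⟨S, R, h1, h2, h3, h4, h5, h6, h7⟩

variable {H₁ : Type*} [NormedAddCommGroup H₁] [InnerProductSpace ℂ H₁] [CompleteSpace H₁]
variable {H₂ : Type*} [NormedAddCommGroup H₂] [InnerProductSpace ℂ H₂] [CompleteSpace H₂]
variable [TopologicalSpace.SeparableSpace H₁] [TopologicalSpace.SeparableSpace H₂]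
variable {ν₁ : POVM X H₁} {ν₂ : POVM X H₂} {ν₁₂ : POVM X (HTensor H₁ H₂)}

theorem funTensor_mem_qrvSpan {S : X → (H₁ →L[ℂ] H₁)} {T : X → (H₂ →L[ℂ] H₂)}
    (hS : S ∈ qrvSpan X H₁) (hT : T ∈ qrvSpan X H₂) (hS0 : ∀ x, 0 ≤ S x) (hT0 : ∀ x, 0 ≤ T x) :
    funTensor S T ∈ qrvSpan X (HTensor H₁ H₂) :=
  mem_qrvSpan_of_nonneg
    ((weakMeasurable_of_mem_qrvSpan hS).funTensor (weakMeasurable_of_mem_qrvSpan hT))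
    fun x => opTensor_nonneg (hS0 x) (hT0 x)

/-- Hölder's inequality for the decomposable separable norm, for a class of majorants that
contains the tensor products of positive functions of finite norm. -/
theorem IsTensorPOVM.sepDecNorm_funTensor_le (h : IsTensorPOVM μ ν₁ ν₂ ν₁₂)
    (h₁ : HasRNDeriv ν₁ μ) (h₂ : HasRNDeriv ν₂ μ) {p q : ℝ} (hpq : p.HolderConjugate q)
    {f : X → (H₁ →L[ℂ] H₁)} {g : X → (H₂ →L[ℂ] H₂)} (hf : pNorm ν₁ μ p f < ∞)
    (hg : pNorm ν₂ μ q g < ∞) {C : Set (X → (HTensor H₁ H₂ →L[ℂ] HTensor H₁ H₂))}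
    (hC : ∀ (S : X → (H₁ →L[ℂ] H₁)) (T : X → (H₂ →L[ℂ] H₂)), S ∈ qrvSpan X H₁ →
      T ∈ qrvSpan X H₂ → (∀ x, 0 ≤ S x) → (∀ x, 0 ≤ T x) → pNorm ν₁ μ p S < ∞ →
      pNorm ν₂ μ q T < ∞ → funTensor S T ∈ C) :
    sepDecNorm C ν₁₂ μ 1 (funTensor f g) ≤ decNorm ν₁ μ p f * decNorm ν₂ μ q g := by
  have hf' : decNorm ν₁ μ p f ≠ ∞ := ((decNorm_le_pNorm p f).trans_lt hf).ne
  have hg' : decNorm ν₂ μ q g ≠ ∞ := ((decNorm_le_pNorm q g).trans_lt hg).ne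
  -- Majorants within arbitrary `a`, `b` above the infima suffice; finiteness of both factors rules
  -- out the product `0 * ∞`.
  refine ENNReal.le_mul_of_forall_lt (Or.inr hg') (Or.inl hf') fun a ha b hb => ?_
  obtain ⟨S₁, R₁, hS₁, hR₁, hS₁0, hR₁0, hB₁, hSa, hRa⟩ := exists_of_decNorm_lt ha
  obtain ⟨S₂, R₂, hS₂, hR₂, hS₂0, hR₂0, hB₂, hSb, hRb⟩ := exists_of_decNorm_lt hb
  refine iInf_le_of_le (funTensor S₁ S₂) (iInf₂_le_of_le (funTensor R₁ R₂)
    ⟨hC S₁ S₂ hS₁ hS₂ hS₁0 hS₂0 hSa.lt_top hSb.lt_top,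
      hC R₁ R₂ hR₁ hR₂ hR₁0 hR₂0 hRa.lt_top hRb.lt_top,
      fun x => opTensor_nonneg (hS₁0 x) (hS₂0 x), fun x => opTensor_nonneg (hR₁0 x) (hR₂0 x), ?_⟩
    (max_le ?_ ?_))
  · filter_upwards [hB₁, hB₂] with x hx₁ hx₂ using hx₁.opTensor hx₂
  · exact (h.sepNorm_funTensor_le h₁ h₂ hpq (weakMeasurable_of_mem_qrvSpan hS₁)
      (weakMeasurable_of_mem_qrvSpan hS₂)).trans (mul_le_mul' hSa.le hSb.le)
  · exact (h.sepNorm_funTensor_le h₁ h₂ hpq (weakMeasurable_of_mem_qrvSpan hR₁)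
      (weakMeasurable_of_mem_qrvSpan hR₂)).trans (mul_le_mul' hRa.le hRb.le)

end Dec

/-! ### Finite dimension: tensored majorants belong to `L¹`. -/

section FiniteDimensional

instance finite_onbIndex {K : Type*} [NormedAddCommGroup K] [InnerProductSpace ℂ K]
    [CompleteSpace K] [FiniteDimensional ℂ K] : Finite (onbIndex K) :=
  (onb K).orthonormal.linearIndependent.finite

/-- A positive operator is bounded by its trace. -/
theorem norm_le_norm_sum_inner {K : Type*} [NormedAddCommGroup K] [InnerProductSpace ℂ K]
    [CompleteSpace K] [Fintype (onbIndex K)] {A : K →L[ℂ] K} (hA : 0 ≤ A) :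
    ‖A‖ ≤ ‖∑ i, inner ℂ (onb K i) (A (onb K i))‖ := by
  simp only [inner_self_eq_norm_sqrt_sq hA, ← Complex.ofReal_sum]
  rw [Complex.norm_real, Real.norm_of_nonneg (by positivity)]
  -- The constant is the trace of `A`; applying the bound twice passes from `√A` to `A = √A √A`.
  have hR : ∀ x, ‖opSqrt A x‖ ^ 2 ≤ (∑ i, ‖opSqrt A (onb K i)‖ ^ 2) * ‖x‖ ^ 2 := fun x => by
    rw [← (hasSum_norm_inner_sq (opSqrt A x)).tsum_eq, tsum_fintype, Finset.sum_mul]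
    refine Finset.sum_le_sum fun i _ => ?_
    rw [← inner_comm_of_nonneg (opSqrt_nonneg A), ← mul_pow]
    gcongr
    exact norm_inner_le_norm _ _
  set c := ∑ i, ‖opSqrt A (onb K i)‖ ^ 2
  have hc : 0 ≤ c := by positivity
  refine ContinuousLinearMap.opNorm_le_bound _ hc fun x => ?_
  rw [← opSqrt_opSqrt_apply hA]
  refine abs_le_of_sq_le_sq' ?_ (by positivity) |>.2
  calc ‖opSqrt A (opSqrt A x)‖ ^ 2 ≤ c * ‖opSqrt A x‖ ^ 2 := hR _
    _ ≤ c * (c * ‖x‖ ^ 2) := by gcongr; exact hR x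
    _ = (c * ‖x‖) ^ 2 := by ring

variable {X : Type*} [MeasurableSpace X] {μ : Measure X}

/-- The pointwise trace of a positive function of finite norm lies in `L^p`. -/
theorem memLp_sum_stateFun {K : Type*} [NormedAddCommGroup K] [InnerProductSpace ℂ K]
    [CompleteSpace K] [TopologicalSpace.SeparableSpace K] [Fintype (onbIndex K)] {ν : POVM X K}
    (hν : HasRNDeriv ν μ) {p : ℝ} {f : X → (K →L[ℂ] K)} (hf : WeakMeasurable f)
    (hp : pNorm ν μ p f < ∞) :
    MemLp (fun x => ∑ i, stateFun ν μ (InnerProductSpace.rankOne ℂ (onb K i) (onb K i)) f x)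
      (ENNReal.ofReal p) μ := by
  refine memLp_finsetSum _ fun i _ => ?_
  have hs := isState_rankOne ((onb K).orthonormal.1 i)
  exact ⟨(measurable_stateFun hν hs hf).aestronglyMeasurable,
    (eLpNorm_stateFun_le_pNorm hs p f).trans_lt hp⟩

variable {H₁ : Type*} [NormedAddCommGroup H₁] [InnerProductSpace ℂ H₁] [CompleteSpace H₁]
variable {H₂ : Type*} [NormedAddCommGroup H₂] [InnerProductSpace ℂ H₂] [CompleteSpace H₂]
variable [TopologicalSpace.SeparableSpace H₁] [TopologicalSpace.SeparableSpace H₂]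
variable {ν₁ : POVM X H₁} {ν₂ : POVM X H₂} {ν : POVM X (HTensor H₁ H₂)}

/-- `pNorm` tests all states, including entangled ones, for which nothing factorises. Instead `|tr
(s (A ⊗ B))| ≤ ‖A‖ ‖B‖ ≤ tr A · tr B` for positive `A`, `B`, and the two traces are finite sums over
vector states, so scalar Hölder applies. -/
theorem IsTensorPOVM.funTensor_mem_lpSpace (h : IsTensorPOVM μ ν₁ ν₂ ν) (h₁ : HasRNDeriv ν₁ μ)
    (h₂ : HasRNDeriv ν₂ μ) [FiniteDimensional ℂ H₁] [FiniteDimensional ℂ H₂] {p q : ℝ}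
    (hpq : p.HolderConjugate q) {S : X → (H₁ →L[ℂ] H₁)} {T : X → (H₂ →L[ℂ] H₂)}
    (hS : S ∈ qrvSpan X H₁) (hT : T ∈ qrvSpan X H₂) (hS0 : ∀ x, 0 ≤ S x) (hT0 : ∀ x, 0 ≤ T x)
    (hSp : pNorm ν₁ μ p S < ∞) (hTq : pNorm ν₂ μ q T < ∞) :
    funTensor S T ∈ lpSpace ν μ 1 := by
  have := Fintype.ofFinite (onbIndex H₁)
  have := Fintype.ofFinite (onbIndex H₂)
  have hmem := funTensor_mem_qrvSpan hS hT hS0 hT0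
  have ha := memLp_sum_stateFun h₁ (weakMeasurable_of_mem_qrvSpan hS) hSp
  have hb := memLp_sum_stateFun h₂ (weakMeasurable_of_mem_qrvSpan hT) hTq
  refine ⟨hmem, (pNorm_le_of_nonneg hmem (fun x => opTensor_nonneg (hS0 x) (hT0 x))
    fun s hs => ?_).trans_lt (ENNReal.mul_lt_top ha.2 hb.2)⟩
  refine le_trans (eLpNorm_mono_ae ?_) (eLpNorm_mul_le_of_holderConjugate hpq
    (Finset.measurable_fun_sum _ fun i _ => measurable_stateFun h₁
      (isState_rankOne ((onb H₁).orthonormal.1 i)) (weakMeasurable_of_mem_qrvSpan hS))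
    (Finset.measurable_fun_sum _ fun i _ => measurable_stateFun h₂
      (isState_rankOne ((onb H₂).orthonormal.1 i)) (weakMeasurable_of_mem_qrvSpan hT)))
  filter_upwards [h.stateFun_ae_eq h₁ h₂ S T] with x hx
  rw [hx, norm_mul]
  refine (hs.norm_tr_le _).trans ((norm_opTensor_le _ _).trans ?_)
  simp only [stateFun_eq, tr_rankOne_mul ((onb H₁).orthonormal.1 _),
    tr_rankOne_mul ((onb H₂).orthonormal.1 _)]
  exact mul_le_mul (norm_le_norm_sum_inner (conj_nonneg (opSqrt_nonneg _) (hS0 x)))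
    (norm_le_norm_sum_inner (conj_nonneg (opSqrt_nonneg _) (hT0 x))) (norm_nonneg _)
    (norm_nonneg _)

end FiniteDimensional

end QRV

end

theorem mainTheorem6
    {H : Type*} [NormedAddCommGroup H] [InnerProductSpace ℂ H] [CompleteSpace H]
    [TopologicalSpace.SeparableSpace H]
    {X : Type*} [TopologicalSpace X] [T2Space X] [LocallyCompactSpace X]
    [MeasurableSpace X] [BorelSpace X]
    (ν : QRV.POVM X H) (ρ : H →L[ℂ] H) (hρ : QRV.IsState ρ) (hρ_inj : Function.Injective ρ)
    (hν : QRV.HasRNDeriv ν (ν.scalarMeasure ρ hρ))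
    (νν : QRV.POVM X (QRV.HTensor H H))
    (hνν : QRV.IsTensorPOVM (ν.scalarMeasure ρ hρ) ν ν νν)
    (p q : ℝ) (hpq : p.HolderConjugate q)
    (f g : X → (H →L[ℂ] H))
    (hf : f ∈ QRV.lpSpace ν (ν.scalarMeasure ρ hρ) p)
    (hg : g ∈ QRV.lpSpace ν (ν.scalarMeasure ρ hρ) q) :
    QRV.sepNorm νν (ν.scalarMeasure ρ hρ) 1 (QRV.funTensor f g) ≤
        QRV.pNorm ν (ν.scalarMeasure ρ hρ) p f * QRV.pNorm ν (ν.scalarMeasure ρ hρ) q g ∧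
    QRV.sepDecNorm (QRV.qrvSpan X (QRV.HTensor H H)) νν (ν.scalarMeasure ρ hρ) 1
          (QRV.funTensor f g) ≤
        QRV.decNorm ν (ν.scalarMeasure ρ hρ) p f * QRV.decNorm ν (ν.scalarMeasure ρ hρ) q g ∧
    (FiniteDimensional ℂ H →
      QRV.sepDecNorm (QRV.lpSpace νν (ν.scalarMeasure ρ hρ) 1) νν (ν.scalarMeasure ρ hρ) 1
          (QRV.funTensor f g) ≤
        QRV.decNorm ν (ν.scalarMeasure ρ hρ) p f * QRV.decNorm ν (ν.scalarMeasure ρ hρ) q g) := by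
  have hfm := QRV.weakMeasurable_of_mem_qrvSpan hf.1
  have hgm := QRV.weakMeasurable_of_mem_qrvSpan hg.1
  refine ⟨hνν.sepNorm_funTensor_le hν hν hpq hfm hgm, ?_, fun _ => ?_⟩
  · exact hνν.sepDecNorm_funTensor_le hν hν hpq hf.2 hg.2
      fun S T hS hT hS0 hT0 _ _ => QRV.funTensor_mem_qrvSpan hS hT hS0 hT0
  · exact hνν.sepDecNorm_funTensor_le hν hν hpq hf.2 hg.2
      fun S T hS hT hS0 hT0 hSp hTq => hνν.funTensor_mem_lpSpace hν hν hpq hS hT hS0 hT0 hSp hTq
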